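/- Let $(\mathbb M,<,\dots)$ be a linearly ordered first-order structure in a language containing a symbol for the order, and suppose that its complete theory is weakly o-minimal, i.e. in every model $\mathcal N$ of it every subset of $\mathcal N$ definable with parameters is a finite union of convex sets. Let $A\subseteq\mathbb M$, let $D\subseteq\mathbb M^n$ and let $(D,\triangleleft)$ be an $A$-definable linear order, and let $f:\mathbb M\to D$ be an $A$-definable function. An equivalence relation on $\mathbb M$ is called convex if all of its classes are convex. For a relation $\prec$ and an equivalence relation $E$ on $\mathbb M$ put $x\prec_E y$ iff $(E(x,y)\wedge y\prec x)\vee(\neg E(x,y)\wedge x\prec y)$, and for a finite sequence $\vec E=(E_1,\dots,E_m)$ put ${<_{\vec E}}:=(\dots(<_{E_1})_{E_2}\dots)_{E_m}$. (i) There are a finite partition $\mathcal C$ of $\mathbb M$ into convex $A$-definable sets and a $\subseteq$-increasing finite sequence $\vec E$ of $A$-definable convex equivalence relations on $\mathbb M$ such that $f$ is $(<_{\vec E},\triangleleft)$-increasing on each $C\in\mathcal C$, i.e. for all $x,y\in C$, $x<_{\vec E}y$ implies $f(x)\mathrel{\triangleleft}f(y)$ or $f(x)=f(y)$. (ii) There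 are a finite partition $\mathcal C$ of $\mathbb M$ into convex $A$-definable sets and a convex $A$-definable equivalence relation $E$ on $\mathbb M$ with only finitely many finite classes, such that $E=\bigcup_{C\in\mathcal C}E_{\restriction C}$ (every $E$-class lies in a single member of $\mathcal C$) and for every $C\in\mathcal C$ one of the following holds: $f_{\restriction [a]_E}$ is constant for all $a\in C$; or $f_{\restriction [a]_E}$ is strictly $(<,\triangleleft)$-increasing for all $a\in C$; or $f_{\restriction [a]_E}$ is strictly $(<,\triangleleft)$-decreasing for all $a\in C$. -/

import Mathlib

universe u v w

open FirstOrder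

namespace WeakMono

/-- A linearly ordered first-order structure is weakly o-minimal if every subset that is definable
with parameters is a finite union of convex sets. -/
def WeaklyOMinimalStructure (L : FirstOrder.Language.{u, v}) (N : Type w) [L.Structure N]
    [LinearOrder N] : Prop :=
  ∀ S : Set N, (Set.univ : Set N).Definable₁ L S →
    ∃ F : Set (Set N), F.Finite ∧ (∀ C ∈ F, C.OrdConnected) ∧ S = ⋃₀ F

/-- A theory in a language with an order symbol is weakly o-minimal if all of its models, linearly
ordered by that symbol, are weakly o-minimal. (It is used for complete theories of linearly ordered
structures, all of whose models are linearly ordered by the symbol.) -/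
def WeaklyOMinimalTheory {L : FirstOrder.Language.{u, v}} [L.IsOrdered] (T : L.Theory) : Prop :=
  ∀ (N : Type w) [L.Structure N] [LinearOrder N] [L.OrderedStructure N],
    N ⊨ T → WeaklyOMinimalStructure L N

/-- The relation `<_E`: reverse `lt` inside each class of `E`, and keep it between classes. -/
def reverseOn {X : Type w} (lt : X → X → Prop) (E : Setoid X) (x y : X) : Prop :=
  (E x y ∧ lt y x) ∨ (¬ E x y ∧ lt x y)

/-- The relation `(…(<_{E₁})_{E₂}…)_{Eₙ}` for a finite sequence `E₁, …, Eₙ`. -/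
def reverseSeq {X : Type w} (lt : X → X → Prop) (Es : List (Setoid X)) : X → X → Prop :=
  Es.foldl reverseOn lt

/-- An equivalence relation is convex if all of its classes are convex. -/
def IsConvexEquiv {X : Type w} [LinearOrder X] (E : Setoid X) : Prop :=
  ∀ a : X, {x | E x a}.OrdConnected

section Definability

variable (L : FirstOrder.Language.{u, v}) {M : Type w} [L.Structure M] (A : Set M)

/-- An `A`-definable equivalence relation. -/
def DefinableEquiv (E : Setoid M) : Prop :=
  A.Definable₂ L {q : M × M | E q.1 q.2}

/-- A finite partition of `M` into (non-empty) convex `A`-definable sets. -/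
def IsFiniteConvexDefinablePartition [LinearOrder M] (P : Set (Set M)) : Prop :=
  P.Finite ∧ Setoid.IsPartition P ∧ ∀ C ∈ P, C.OrdConnected ∧ A.Definable₁ L C

/-- `(D, tri)` is an `A`-definable (strict) linear order, with `D` a subset of `Mⁿ`. -/
def IsDefinableLinearOrder {n : ℕ} (D : Set (Fin n → M)) (tri : D → D → Prop) : Prop :=
  A.Definable L D ∧
  A.Definable L {v : Fin n ⊕ Fin n → M |
    ∃ (hx : v ∘ Sum.inl ∈ D) (hy : v ∘ Sum.inr ∈ D), tri ⟨_, hx⟩ ⟨_, hy⟩} ∧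
  IsStrictTotalOrder D tri

/-- The function `f : M → D`, with `D` a subset of `Mⁿ`, has an `A`-definable graph. -/
def IsDefinableFun {n : ℕ} {D : Set (Fin n → M)} (f : M → D) : Prop :=
  A.Definable L {v : Unit ⊕ Fin n → M | (f (v (Sum.inl ())) : Fin n → M) = v ∘ Sum.inr}

end Definability

section Monotone

variable {X : Type*} {Y : Type*} (ltX : X → X → Prop) (ltY : Y → Y → Prop) (f : X → Y)
  (S : Set X)

/-- The restriction of `f` to `S` is (weakly) increasing with respect to two strict orders. -/
def IncreasingOnRel : Prop :=
  ∀ x ∈ S, ∀ y ∈ S, ltX x y → ltY (f x) (f y) ∨ f x = f y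

/-- The restriction of `f` to `S` is strictly increasing with respect to two strict orders. -/
def StrictIncreasingOnRel : Prop :=
  ∀ x ∈ S, ∀ y ∈ S, ltX x y → ltY (f x) (f y)

/-- The restriction of `f` to `S` is strictly decreasing with respect to two strict orders. -/
def StrictDecreasingOnRel : Prop :=
  ∀ x ∈ S, ∀ y ∈ S, ltX x y → ltY (f y) (f x)

/-- The restriction of `f` to `S` is constant. -/
def ConstantOn : Prop :=
  ∀ x ∈ S, ∀ y ∈ S, f x = f y

end Monotone

end WeakMono

/-! ### Definable relations of the reduct `(M, <, F)`. -/

namespace WeakMono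

/-! Only the total preorder `F x y`, meaning `f x ≤ f y`, matters. The parameters and the possibly
uncountable language are hidden in `F`, so the reduct `(M, <, F)` has countably many definable
relations and its ultrapower over `ℕ` realizes the types needed. Weak o-minimality enters twice:
definable sets are finite unions of convex sets (`TameSets`), and, since it holds in an ultrapower
of the full structure too, one number bounds the changes of position of `f x` relative to `f w`
along increasing `x`, for all `w` (`exists_uniform_alt_bound`).

For (i), compactness reduces the claim to finding, for each ultrafilter `V` on `M`, a definable set
in `V` on which `f` is increasing up to reversals (`exists_finite_simple_cover`). The realizations
of the type of `V` form a convex set, the locus, and look alike by homogeneity. Hence inside the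
classes of a convex `E`, going right from any `a` of the locus, `f x` ends above `f a` for every
`a`, or below for every `a`, or `f` is constant on classes (`final_position`). If it ends above,
identify `a ≤ b` when some `y ≥ b` in the class has `f y ≤ f a`. This is a convex equivalence
relation `E'`: otherwise homogeneity would iterate one bad configuration into unboundedly many
position changes (`not_nested`). Between `E'`-classes `f` increases, and inside them one position
change fewer is possible, because another always follows (`exists_refinement`). Induction on this
number (`good_of_chainBound`) produces the sequence of reversals; the case below is the same for the
opposite of `F`, at the cost of extra reversals.

For (ii), every nontrivial interval in a cell of (i) has a nontrivial subinterval on which finitely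
many reversals amount to `<` or `>`, hence one on which `f` is constant or strictly monotone. Three
convex equivalence relations record these behaviors and are glued over a finer partition
(`exists_locally_monotone_partition`). -/

/-- Prepend an element to an assignment of the variables. -/
def cons {M : Type*} (x : M) (v : ℕ → M) : ℕ → M
  | 0 => x
  | n + 1 => v n

@[simp] theorem cons_zero {M : Type*} (x : M) (v : ℕ → M) : cons x v 0 = x := rfl

@[simp] theorem cons_succ {M : Type*} (x : M) (v : ℕ → M) (n : ℕ) : cons x v (n + 1) = v n := rfl

/-- The relations definable without parameters in the structure `(M, <, F)`, as predicates of
assignments of the variables. -/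
inductive Dfn {M : Type*} [LinearOrder M] (F : M → M → Prop) : ((ℕ → M) → Prop) → Prop
  | lt : Dfn F (fun v => v 0 < v 1)
  | rel : Dfn F (fun v => F (v 0) (v 1))
  | not {p} : Dfn F p → Dfn F (fun v => ¬ p v)
  | and {p q} : Dfn F p → Dfn F q → Dfn F (fun v => p v ∧ q v)
  | ex {p} : Dfn F p → Dfn F (fun v => ∃ x, p (cons x v))
  | ren {p} (l : List ℕ) : Dfn F p → Dfn F (fun v => p (fun k => v (l.getD k 0)))

section Dfn

variable {M : Type*} [LinearOrder M] {F : M → M → Prop}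

/-- A definable set. -/
abbrev Dfn1 (F : M → M → Prop) (S : Set M) : Prop := Dfn F (fun v => v 0 ∈ S)

/-- A definable binary relation. -/
abbrev Dfn2 (F : M → M → Prop) (e : M → M → Prop) : Prop := Dfn F (fun v => e (v 0) (v 1))

theorem Dfn.congr {p q : (ℕ → M) → Prop} (h : Dfn F p) (hpq : ∀ v, q v ↔ p v) : Dfn F q := by
  have : q = p := funext fun v => propext (hpq v)
  rwa [this]

theorem Dfn.or {p q : (ℕ → M) → Prop} (hp : Dfn F p) (hq : Dfn F q) :
    Dfn F (fun v => p v ∨ q v) :=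
  (Dfn.not (hp.not.and hq.not)).congr fun v => by tauto

theorem Dfn.imp {p q : (ℕ → M) → Prop} (hp : Dfn F p) (hq : Dfn F q) :
    Dfn F (fun v => p v → q v) :=
  (hp.not.or hq).congr fun _ => by tauto

theorem Dfn.iff {p q : (ℕ → M) → Prop} (hp : Dfn F p) (hq : Dfn F q) :
    Dfn F (fun v => p v ↔ q v) :=
  ((hp.imp hq).and (hq.imp hp)).congr fun v => by tauto

theorem Dfn.all {p : (ℕ → M) → Prop} (hp : Dfn F p) : Dfn F (fun v => ∀ x, p (cons x v)) :=
  (Dfn.not hp.not.ex).congr fun v => by simp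

theorem Dfn.const (P : Prop) : Dfn F (fun _ => P) := by
  by_cases h : P
  · exact (Dfn.lt.or Dfn.lt.not).congr fun v => by tauto
  · exact (Dfn.lt.and Dfn.lt.not).congr fun v => by tauto

theorem Dfn2.sub {e : M → M → Prop} (h : Dfn2 F e) (i j : ℕ) : Dfn F (fun v => e (v i) (v j)) :=
  Dfn.ren [i, j] h

theorem Dfn1.sub {S : Set M} (h : Dfn1 F S) (i : ℕ) : Dfn F (fun v => v i ∈ S) :=
  Dfn.ren [i] h

theorem Dfn.lt' (i j : ℕ) : Dfn F (fun v => v i < v j) := Dfn2.sub Dfn.lt i j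

theorem Dfn.rel' (i j : ℕ) : Dfn F (fun v => F (v i) (v j)) := Dfn2.sub Dfn.rel i j

theorem Dfn.le' (i j : ℕ) : Dfn F (fun v => v i ≤ v j) :=
  (Dfn.lt' j i).not.congr fun v => by simp

theorem Dfn.eq' (i j : ℕ) : Dfn F (fun v => v i = v j) :=
  ((Dfn.le' i j).and (Dfn.le' j i)).congr fun _ => le_antisymm_iff

theorem Dfn1.inter {S T : Set M} (hS : Dfn1 F S) (hT : Dfn1 F T) : Dfn1 F (S ∩ T) :=
  Dfn.and hS hT

theorem Dfn1.compl {S : Set M} (hS : Dfn1 F S) : Dfn1 F Sᶜ :=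
  Dfn.not hS

/-- Lets results for increasing behavior be applied to decreasing behavior, by exchanging `F` with
its opposite. -/
theorem Dfn.swap {p : (ℕ → M) → Prop} (h : Dfn F p) : Dfn (fun x y => F y x) p := by
  induction h with
  | lt => exact .lt
  | rel => exact Dfn.rel' 1 0
  | not _ ih => exact ih.not
  | and _ _ ih ih' => exact ih.and ih'
  | ex _ ih => exact ih.ex
  | ren l _ ih => exact ih.ren l

/-- The predicates obtained by at most `n` rounds of the closure operations. -/
def dfnLevel (F : M → M → Prop) : ℕ → Set ((ℕ → M) → Prop)
  | 0 => {fun v => v 0 < v 1, fun v => F (v 0) (v 1)}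
  | n + 1 => dfnLevel F n ∪ (fun p v => ¬ p v) '' dfnLevel F n ∪
      Set.image2 (fun p q v => p v ∧ q v) (dfnLevel F n) (dfnLevel F n) ∪
      (fun p v => ∃ x, p (cons x v)) '' dfnLevel F n ∪
      Set.image2 (fun (l : List ℕ) p v => p (fun k => v (l.getD k 0))) Set.univ (dfnLevel F n)

theorem countable_dfnLevel (n : ℕ) : (dfnLevel F n).Countable := by
  induction n with
  | zero => exact ((Set.finite_singleton _).insert _).countable
  | succ n ih =>
    exact (((ih.union (ih.image _)).union (ih.image2 ih _)).union (ih.image _)).union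
      (Set.countable_univ.image2 ih _)

theorem monotone_dfnLevel : Monotone (dfnLevel F) :=
  monotone_nat_of_le_succ fun _ _ hp => Or.inl (Or.inl (Or.inl (Or.inl hp)))

/-- Countability is what allows an ultrapower over `ℕ` to realize complete types of the reduct. -/
theorem countable_dfn : {p | Dfn F p}.Countable := by
  refine (Set.countable_iUnion (countable_dfnLevel (F := F))).mono fun p hp => ?_
  rw [Set.mem_iUnion]
  induction hp with
  | lt => exact ⟨0, Or.inl rfl⟩
  | rel => exact ⟨0, Or.inr rfl⟩
  | not _ ih =>
    obtain ⟨n, h⟩ := ih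
    exact ⟨n + 1, Or.inl (Or.inl (Or.inl (Or.inr ⟨_, h, rfl⟩)))⟩
  | and _ _ ih ih' =>
    obtain ⟨n, h⟩ := ih
    obtain ⟨m, h'⟩ := ih'
    exact ⟨max n m + 1, Or.inl (Or.inl (Or.inr ⟨_, monotone_dfnLevel (le_max_left _ _) h, _,
      monotone_dfnLevel (le_max_right _ _) h', rfl⟩))⟩
  | ex _ ih =>
    obtain ⟨n, h⟩ := ih
    exact ⟨n + 1, Or.inl (Or.inr ⟨_, h, rfl⟩)⟩
  | ren l _ ih =>
    obtain ⟨n, h⟩ := ih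
    exact ⟨n + 1, Or.inr ⟨l, trivial, _, h, rfl⟩⟩

end Dfn

/-! ### Color changes along increasing chains. -/

section Alternation

variable {M κ : Type*} [LinearOrder M]

/-- `Alt c X n x`: there is an increasing chain of length `n + 1` in `X` that ends at `x` and in
which consecutive elements have different colors. -/
def Alt (c : M → κ) (X : Set M) : ℕ → M → Prop
  | 0, x => x ∈ X
  | n + 1, x => x ∈ X ∧ ∃ y, y < x ∧ Alt c X n y ∧ c y ≠ c x

theorem Alt.mem {c : M → κ} {X : Set M} : ∀ {n : ℕ} {x : M}, Alt c X n x → x ∈ X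
  | 0, _, h => h
  | _ + 1, _, h => h.1

theorem Alt.mono {c : M → κ} {X Y : Set M} (hXY : X ⊆ Y) :
    ∀ {n : ℕ} {x : M}, Alt c X n x → Alt c Y n x
  | 0, _, h => hXY h
  | _ + 1, _, ⟨h, y, hy, hn, hc⟩ => ⟨hXY h, y, hy, hn.mono hXY, hc⟩

theorem Alt.exists_of_le {c : M → κ} {X : Set M} {m n : ℕ} (hmn : m ≤ n) {x : M}
    (h : Alt c X n x) : ∃ y, Alt c X m y := by
  induction n generalizing x with
  | zero => exact ⟨x, by rwa [Nat.le_zero.1 hmn]⟩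
  | succ n ih =>
    rcases Nat.lt_or_ge n m with h' | h'
    · exact ⟨x, by rwa [le_antisymm hmn h']⟩
    · obtain ⟨_, y, _, hy, _⟩ := h
      exact ih h' hy

/-- Each color change enters a new piece: a piece containing `x` and a point below the previous link
`y` would contain `y` by convexity, contradicting the change of color. So the number of pieces that
reach below `x` grows strictly along the chain. -/
theorem Alt.lt_ncard {c : M → κ} {X : Set M} {G : Set (Set M)} (hG : G.Finite)
    (hconv : ∀ C ∈ G, C.OrdConnected) (hcov : ∀ x ∈ X, ∃ C ∈ G, x ∈ C)
    (hc : ∀ C ∈ G, ∀ x ∈ C, ∀ y ∈ C, c x = c y) {n : ℕ} {x : M} (h : Alt c X n x) :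
    n < G.ncard := by
  suffices n < {C ∈ G | ∃ y ∈ C, y ≤ x}.ncard from
    this.trans_le (Set.ncard_le_ncard (Set.sep_subset _ _) hG)
  induction n generalizing x with
  | zero =>
    obtain ⟨C, hC, hx⟩ := hcov x h
    rw [Set.ncard_pos (hG.subset (Set.sep_subset _ _))]
    exact ⟨C, hC, x, hx, le_rfl⟩
  | succ n ih =>
    obtain ⟨hx, y, hyx, hy, hne⟩ := h
    refine Nat.lt_of_le_of_lt (ih hy) (Set.ncard_lt_ncard ?_ (hG.subset (Set.sep_subset _ _)))
    refine ⟨fun C ⟨hC, z, hz, hzy⟩ => ⟨hC, z, hz, hzy.trans hyx.le⟩, fun hsub => ?_⟩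
    obtain ⟨C, hC, hxC⟩ := hcov x hx
    obtain ⟨_, z, hz, hzy⟩ := hsub ⟨hC, x, hxC, le_rfl⟩
    exact hne (hc C hC y ((hconv C hC).out hz hxC ⟨hzy, hyx.le⟩) x hxC)

end Alternation

/-! ### Finite partitions into convex definable sets. -/

section Partition

variable {M : Type*} [LinearOrder M] {F : M → M → Prop}

/-- Every definable set is a finite union of convex sets. -/
def TameSets (F : M → M → Prop) : Prop :=
  ∀ S, Dfn1 F S → ∃ G : Set (Set M), G.Finite ∧ (∀ C ∈ G, C.OrdConnected) ∧ S = ⋃₀ G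

/-- A finite partition into convex definable sets. -/
structure ConvexPartition (F : M → M → Prop) (P : Set (Set M)) : Prop where
  finite : P.Finite
  isPartition : Setoid.IsPartition P
  convex : ∀ C ∈ P, C.OrdConnected
  dfn : ∀ C ∈ P, Dfn1 F C

theorem ConvexPartition.exists_mem {P : Set (Set M)} (h : ConvexPartition F P) (x : M) :
    ∃ C ∈ P, x ∈ C := by
  obtain ⟨C, ⟨h1, h2⟩, _⟩ := h.isPartition.2 x
  exact ⟨C, h1, h2⟩

theorem ConvexPartition.eq {P : Set (Set M)} (h : ConvexPartition F P) {x : M} {C D : Set M}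
    (hC : C ∈ P) (hD : D ∈ P) (hx : x ∈ C) (hx' : x ∈ D) : C = D :=
  (h.isPartition.2 x).unique ⟨hC, hx⟩ ⟨hD, hx'⟩

/-- Elements above an alternating chain of length `n` that starts in `S`. -/
def alternation (S : Set M) : ℕ → Set M
  | 0 => Set.univ
  | n + 1 => {x | ∃ y, y ≤ x ∧ y ∈ alternation S n ∧ (y ∈ S ↔ Even n)}

theorem dfn_alternation {S : Set M} (hS : Dfn1 F S) (n : ℕ) : Dfn1 F (alternation S n) := by
  induction n with
  | zero => exact (Dfn.const True).congr fun v => by simp [alternation]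
  | succ n ih => exact ((Dfn.le' 0 1).and (Dfn.and ih (Dfn.iff hS (Dfn.const (Even n))))).ex

theorem isUpperSet_alternation (S : Set M) (n : ℕ) : IsUpperSet (alternation S n) := by
  cases n with
  | zero => exact isUpperSet_univ
  | succ n => exact fun x y hxy ⟨z, hz, h⟩ => ⟨z, hz.trans hxy, h⟩

theorem alternation_succ_subset (S : Set M) (n : ℕ) : alternation S (n + 1) ⊆ alternation S n :=
  fun _ ⟨_, hy, h, _⟩ => isUpperSet_alternation S n hy h

theorem antitone_alternation (S : Set M) : Antitone (alternation S) :=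
  antitone_nat_of_succ_le (alternation_succ_subset S)

theorem alt_of_mem_alternation {S : Set M} {n : ℕ} {y : M} (hy : y ∈ alternation S n)
    (h : y ∈ S ↔ Even n) : Alt (fun x => x ∈ S) Set.univ n y := by
  induction n generalizing y with
  | zero => trivial
  | succ n ih =>
    obtain ⟨z, hz, hzn, hzS⟩ := hy
    have hne : (z ∈ S) ≠ (y ∈ S) := by
      rw [Nat.even_add_one] at h
      intro h'
      have : z ∈ S ↔ y ∈ S := iff_of_eq h'
      tauto
    exact ⟨trivial, z, lt_of_le_of_ne hz (by rintro rfl; exact hne rfl), ih hzn hzS, hne⟩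

theorem exists_alternation_eq_empty (hW : TameSets F) {S : Set M} (hS : Dfn1 F S) :
    ∃ n, alternation S n = ∅ := by
  obtain ⟨G, hG, hGc, hGS⟩ := hW S hS
  obtain ⟨G', hG', hGc', hGS'⟩ := hW Sᶜ hS.compl
  refine ⟨(G ∪ G').ncard + 1, Set.eq_empty_of_forall_notMem ?_⟩
  rintro x ⟨y, _, hy, hyS⟩
  refine (Alt.lt_ncard (hG.union hG') ?_ ?_ ?_ (alt_of_mem_alternation hy hyS)).false
  · rintro C (h | h)
    exacts [hGc C h, hGc' C h]
  · intro x _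
    by_cases hx : x ∈ S
    · rw [hGS] at hx
      obtain ⟨C, h, h'⟩ := hx
      exact ⟨C, Or.inl h, h'⟩
    · have hx : x ∈ Sᶜ := hx
      rw [hGS'] at hx
      obtain ⟨C, h, h'⟩ := hx
      exact ⟨C, Or.inr h, h'⟩
  · rintro C (h | h) x hx y hy
    · have : ∀ z ∈ C, z ∈ S := fun z hz => by rw [hGS]; exact ⟨C, h, hz⟩
      simp [this x hx, this y hy]
    · have : ∀ z ∈ C, z ∈ Sᶜ := fun z hz => by rw [hGS']; exact ⟨C, h, hz⟩
      exact propext ⟨fun h => absurd h (this x hx), fun h => absurd h (this y hy)⟩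

/-- The sets `alternation S n` are definable upper sets that decrease to the empty set, so their
successive differences are convex, definable and finite in number. -/
theorem exists_convexPartition_single (hW : TameSets F) {S : Set M} (hS : Dfn1 F S) :
    ∃ P, ConvexPartition F P ∧ ∀ C ∈ P, C ⊆ S ∨ Disjoint C S := by
  obtain ⟨N, hN⟩ := exists_alternation_eq_empty hW hS
  set K : ℕ → Set M := fun n => alternation S n \ alternation S (n + 1) with hK
  have hKlt : ∀ n x, x ∈ K n → n < N := fun n x hx => by
    by_contra h
    have := antitone_alternation S (not_lt.1 h) hx.1
    simp [hN] at this
  refine ⟨{C | C.Nonempty ∧ ∃ n, K n = C}, ⟨?_, ⟨?_, ?_⟩, ?_, ?_⟩, ?_⟩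
  · refine ((Set.finite_lt_nat N).image K).subset ?_
    rintro _ ⟨⟨x, hx⟩, n, rfl⟩
    exact ⟨n, hKlt n x hx, rfl⟩
  · rintro ⟨h, -⟩
    exact Set.not_nonempty_empty h
  · intro x
    have hex : ∃ n, x ∉ alternation S n := ⟨N, by simp [hN]⟩
    classical
    obtain ⟨n, hn⟩ : ∃ n, Nat.find hex = n + 1 :=
      Nat.exists_eq_succ_of_ne_zero fun h => (Nat.find_spec hex) (by rw [h]; trivial)
    have hx : x ∈ K n :=
      ⟨not_not.1 (Nat.find_min hex (by omega)), by rw [← hn]; exact Nat.find_spec hex⟩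
    refine ⟨K n, ⟨⟨⟨x, hx⟩, n, rfl⟩, hx⟩, ?_⟩
    rintro _ ⟨⟨_, m, rfl⟩, hm⟩
    have aux : ∀ i j, i < j → x ∈ K i → x ∈ K j → False := fun i j hij hi hj =>
      hi.2 (antitone_alternation S hij hj.1)
    rcases lt_trichotomy m n with h | h | h
    · exact (aux _ _ h hm hx).elim
    · rw [h]
    · exact (aux _ _ h hx hm).elim
  · rintro _ ⟨_, n, rfl⟩
    exact (isUpperSet_alternation S n).ordConnected.inter
      (isUpperSet_alternation S (n + 1)).compl.ordConnected
  · rintro _ ⟨_, n, rfl⟩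
    exact (dfn_alternation hS n).inter (dfn_alternation hS (n + 1)).compl
  · rintro _ ⟨_, n, rfl⟩
    -- A point of `K n` with the right parity would be its own witness for level `n + 1`.
    have key : ∀ x ∈ K n, ¬ (x ∈ S ↔ Even n) := fun x hx h => hx.2 ⟨x, le_rfl, hx.1, h⟩
    by_cases h : Even n
    · exact Or.inr (Set.disjoint_left.2 fun x hx hxS => key x hx (by tauto))
    · exact Or.inl fun x hx => by have := key x hx; tauto

theorem ConvexPartition.inf {P Q : Set (Set M)} (hP : ConvexPartition F P)
    (hQ : ConvexPartition F Q) :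
    ConvexPartition F {C | C.Nonempty ∧ ∃ A ∈ P, ∃ B ∈ Q, A ∩ B = C} := by
  refine ⟨?_, ⟨?_, ?_⟩, ?_, ?_⟩
  · refine (hP.finite.image2 (· ∩ ·) hQ.finite).subset ?_
    rintro _ ⟨_, A, hA, B, hB, rfl⟩
    exact ⟨A, hA, B, hB, rfl⟩
  · rintro ⟨h, -⟩
    exact Set.not_nonempty_empty h
  · intro x
    obtain ⟨A, hA, hxA⟩ := hP.exists_mem x
    obtain ⟨B, hB, hxB⟩ := hQ.exists_mem x
    refine ⟨A ∩ B, ⟨⟨⟨x, hxA, hxB⟩, A, hA, B, hB, rfl⟩, hxA, hxB⟩, ?_⟩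
    rintro _ ⟨⟨_, A', hA', B', hB', rfl⟩, hxA', hxB'⟩
    rw [hP.eq hA hA' hxA hxA', hQ.eq hB hB' hxB hxB']
  · rintro _ ⟨_, A, hA, B, hB, rfl⟩
    exact (hP.convex A hA).inter (hQ.convex B hB)
  · rintro _ ⟨_, A, hA, B, hB, rfl⟩
    exact (hP.dfn A hA).inter (hQ.dfn B hB)

theorem exists_convexPartition (hW : TameSets F) {G : Set (Set M)} (hG : G.Finite)
    (hdfn : ∀ S ∈ G, Dfn1 F S) :
    ∃ P, ConvexPartition F P ∧ ∀ C ∈ P, ∀ S ∈ G, C ⊆ S ∨ Disjoint C S := by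
  induction G, hG using Set.Finite.induction_on with
  | empty =>
    obtain ⟨P, hP, _⟩ := exists_convexPartition_single hW (F := F) (S := Set.univ)
      ((Dfn.const True).congr fun v => by simp)
    exact ⟨P, hP, fun _ _ _ h => h.elim⟩
  | @insert S G _ _ ih =>
    obtain ⟨P, hP, hPG⟩ := ih fun T hT => hdfn T (Or.inr hT)
    obtain ⟨Q, hQ, hQS⟩ := exists_convexPartition_single hW (hdfn S (Or.inl rfl))
    refine ⟨_, hP.inf hQ, ?_⟩
    rintro _ ⟨_, A, hA, B, hB, rfl⟩ T (rfl | hT)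
    · exact (hQS B hB).imp (Set.inter_subset_right.trans ·) (·.mono_left Set.inter_subset_right)
    · exact (hPG A hA T hT).imp (Set.inter_subset_left.trans ·) (·.mono_left Set.inter_subset_left)

end Partition

/-! ### The ultrapower and its countable saturation. -/

open Filter

/-- The ultrapower over the index set `ℕ`. -/
abbrev Star (M : Type*) : Type _ := Germ ((hyperfilter ℕ : Ultrafilter ℕ) : Filter ℕ) M

section Ultrapower

variable {M : Type*}

/-- A sequence that represents an element of the ultrapower. -/
noncomputable def rep (x : Star M) : ℕ → M := Quotient.out x

theorem coe_rep (x : Star M) : ((rep x : ℕ → M) : Star M) = x := Quotient.out_eq x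

theorem rep_coe (x : ℕ → M) : ∀ᶠ i in hyperfilter ℕ, rep (x : Star M) i = x i :=
  Germ.coe_eq.1 (coe_rep (x : Star M))

/-- The truth of an internal predicate in the ultrapower. -/
def star (p : (ℕ → M) → Prop) (v : ℕ → Star M) : Prop :=
  ∀ᶠ i in hyperfilter ℕ, p (fun j => rep (v j) i)

/-- The extension of a binary relation to the ultrapower. -/
def star2 (e : M → M → Prop) (x y : Star M) : Prop :=
  ∀ᶠ i in hyperfilter ℕ, e (rep x i) (rep y i)

/-- The extension of a set to the ultrapower. -/
def star1 (S : Set M) : Set (Star M) := {x | ∀ᶠ i in hyperfilter ℕ, rep x i ∈ S}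

theorem lt_iff_rep [LinearOrder M] (x y : Star M) :
    x < y ↔ ∀ᶠ i in hyperfilter ℕ, rep x i < rep y i := by
  conv_lhs => rw [← coe_rep x, ← coe_rep y]
  exact Germ.coe_lt

theorem le_iff_rep [LinearOrder M] (x y : Star M) :
    x ≤ y ↔ ∀ᶠ i in hyperfilter ℕ, rep x i ≤ rep y i := by
  conv_lhs => rw [← coe_rep x, ← coe_rep y]
  exact Germ.coe_le

/-- At index `i`, solve the longest simultaneously solvable initial segment of the conditions
numbered up to `i`. The ultrafilter is nonprincipal, so `n ≤ i` for almost all `i`, and condition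
`n` is then met. -/
theorem saturation {β : Type*} [Nonempty β] (Q : ℕ → ℕ → β → Prop)
    (h : ∀ n, ∀ᶠ i in hyperfilter ℕ, ∃ y, ∀ k ≤ n, Q k i y) :
    ∃ y : ℕ → β, ∀ n, ∀ᶠ i in hyperfilter ℕ, Q n i (y i) := by
  have key : ∀ i N, ∃ y, ∀ n ≤ N, (∃ y', ∀ k ≤ n, Q k i y') → Q n i y := by
    intro i N
    induction N with
    | zero =>
      by_cases h0 : ∃ y', Q 0 i y'
      · obtain ⟨y, hy⟩ := h0
        exact ⟨y, fun n hn _ => by rwa [Nat.le_zero.1 hn]⟩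
      · refine ⟨Classical.arbitrary β, fun n hn ⟨y', hy'⟩ => ?_⟩
        exact (h0 ⟨y', hy' 0 (Nat.zero_le _)⟩).elim
    | succ N ih =>
      by_cases h0 : ∃ y', ∀ k ≤ N + 1, Q k i y'
      · obtain ⟨y, hy⟩ := h0
        exact ⟨y, fun n hn _ => hy n hn⟩
      · obtain ⟨y, hy⟩ := ih
        refine ⟨y, fun n hn hex => ?_⟩
        rcases Nat.le_succ_iff.1 hn with hn | rfl
        · exact hy n hn hex
        · exact (h0 hex).elim
  choose y hy using fun i => key i i
  refine ⟨y, fun n => ?_⟩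
  have hge : ∀ᶠ i in hyperfilter ℕ, n ≤ i :=
    Nat.hyperfilter_le_atTop (eventually_ge_atTop n)
  filter_upwards [h n, hge] with i h1 h2 using hy i n h2 h1

end Ultrapower

/-! ### Homogeneity of the ultrapower and realizations of a type. -/

section SameType

variable {M : Type*} [LinearOrder M] {F : M → M → Prop}

/-- Two tuples of the ultrapower satisfy the same definable predicates. -/
def SameType (F : M → M → Prop) (v v' : ℕ → Star M) : Prop :=
  ∀ p, Dfn F p → (star p v ↔ star p v')

theorem Dfn.forall_le {p : ℕ → (ℕ → M) → Prop} (h : ∀ k, Dfn F (p k)) (n : ℕ) :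
    Dfn F (fun v => ∀ k ≤ n, p k v) := by
  induction n with
  | zero => exact (h 0).congr fun v => by simp
  | succ n ih =>
    refine (ih.and (h (n + 1))).congr fun v =>
      ⟨fun hk => ⟨fun k hkn => hk k (by omega), hk _ le_rfl⟩, fun hk k hkn => ?_⟩
    rcases Nat.le_succ_iff.1 hkn with hkn | rfl
    exacts [hk.1 k hkn, hk.2]

theorem exists_enum_dfn (F : M → M → Prop) :
    ∃ p : ℕ → (ℕ → M) → Prop, ∀ q, Dfn F q ↔ ∃ k, p k = q := by
  obtain ⟨p, hp⟩ := (countable_dfn (F := F)).exists_eq_range ⟨_, Dfn.lt⟩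
  exact ⟨p, fun q => by rw [← Set.mem_range, ← hp]; rfl⟩

theorem SameType.symm {v v' : ℕ → Star M} (h : SameType F v v') : SameType F v' v :=
  fun p hp => (h p hp).symm

/-- The back-and-forth step: finite parts of the type of `y` over `v` are solvable over `v'` because
existential quantification is definable, and saturation solves them all. -/
theorem SameType.exists_cons {v v' : ℕ → Star M} (h : SameType F v v') (y : Star M) :
    ∃ y', SameType F (cons y v) (cons y' v') := by
  classical
  obtain ⟨e, he⟩ := exists_enum_dfn F
  have heD : ∀ k, Dfn F (e k) := fun k => (he _).2 ⟨k, rfl⟩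
  -- `p k` is `e k` or its negation, whichever `y` satisfies.
  let p : ℕ → (ℕ → M) → Prop := fun k u => e k u ↔ star (e k) (cons y v)
  have hp : ∀ k, Dfn F (p k) := fun k => (heD k).iff (Dfn.const _)
  have hpy : ∀ k, star (p k) (cons y v) := fun k => by
    by_cases hk : star (e k) (cons y v)
    · exact hk.mono fun i hi => ⟨fun _ => hk, fun _ => hi⟩
    · exact (Ultrafilter.eventually_not.2 hk).mono fun i hi =>
        ⟨fun h' => absurd h' hi, fun h' => absurd h' hk⟩
  have hex : ∀ n, ∀ᶠ i in hyperfilter ℕ, ∃ z, ∀ k ≤ n, p k (cons z fun j => rep (v' j) i) := by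
    intro n
    refine (h _ (Dfn.forall_le hp n).ex).1 ?_
    have : ∀ᶠ i in hyperfilter ℕ, ∀ k ∈ Set.Iic n, p k (fun j => rep (cons y v j) i) :=
      (Set.finite_Iic n).eventually_all.2 fun k _ => hpy k
    filter_upwards [this] with i hi
    refine ⟨rep y i, fun k hk => ?_⟩
    convert hi k hk using 1
    funext j
    cases j <;> rfl
  have : Nonempty M := ⟨rep y 0⟩
  obtain ⟨z, hz⟩ := saturation (fun k i z => p k (cons z fun j => rep (v' j) i)) hex
  refine ⟨(z : Star M), fun q hq => ?_⟩
  obtain ⟨k, rfl⟩ := (he q).1 hq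
  have hk : ∀ᶠ i in hyperfilter ℕ,
      (e k (fun j => rep (cons (z : Star M) v' j) i) ↔ star (e k) (cons y v)) := by
    filter_upwards [hz k, rep_coe z] with i h1 h2
    convert h1 using 3 with j
    cases j
    exacts [h2, rfl]
  constructor
  · exact fun hs => hk.mono fun i hi => hi.2 hs
  · intro hs
    obtain ⟨i, h1, h2⟩ := (hk.and hs).exists
    exact h1.1 h2

theorem SameType.star1_iff {v v' : ℕ → Star M} (h : SameType F v v') {S : Set M}
    (hS : Dfn1 F S) (j : ℕ) : v j ∈ star1 S ↔ v' j ∈ star1 S :=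
  h _ (hS.sub j)

theorem SameType.star2_iff {v v' : ℕ → Star M} (h : SameType F v v') {e : M → M → Prop}
    (he : Dfn2 F e) (i j : ℕ) : star2 e (v i) (v j) ↔ star2 e (v' i) (v' j) :=
  h _ (he.sub i j)

theorem SameType.lt_iff {v v' : ℕ → Star M} (h : SameType F v v') (i j : ℕ) :
    v i < v j ↔ v' i < v' j := by
  rw [lt_iff_rep, lt_iff_rep]
  exact h _ (Dfn.lt' i j)

theorem SameType.le_iff {v v' : ℕ → Star M} (h : SameType F v v') (i j : ℕ) :
    v i ≤ v j ↔ v' i ≤ v' j := by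
  rw [le_iff_rep, le_iff_rep]
  exact h _ (Dfn.le' i j)

/-- The realizations in the ultrapower of the complete type given by an ultrafilter. -/
def locus (F : M → M → Prop) (V : Ultrafilter M) : Set (Star M) :=
  {x | ∀ S, Dfn1 F S → S ∈ V → x ∈ star1 S}

variable {V : Ultrafilter M}

theorem SameType.mem_locus {v v' : ℕ → Star M} (h : SameType F v v') {j : ℕ}
    (hj : v j ∈ locus F V) : v' j ∈ locus F V :=
  fun S hS hV => (h.star1_iff hS j).1 (hj S hS hV)

theorem sameType_of_mem_locus {a b : Star M} (ha : a ∈ locus F V) (hb : b ∈ locus F V) :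
    SameType F (fun _ => a) (fun _ => b) := by
  intro p hp
  -- Renaming along the empty list sends every variable to the default `v 0`, which gives the
  -- diagonal.
  have hS : Dfn1 F {m | p fun _ => m} := by
    refine (hp.ren []).congr fun v => ?_
    simp
  rcases V.mem_or_compl_mem {m | p fun _ => m} with hV | hV
  · exact iff_of_true (ha _ hS hV) (hb _ hS hV)
  · exact iff_of_false (Ultrafilter.eventually_not.1 (ha _ hS.compl hV))
      (Ultrafilter.eventually_not.1 (hb _ hS.compl hV))

theorem exists_enum_dfn1 (F : M → M → Prop) (V : Ultrafilter M) :
    ∃ T : ℕ → Set M, ∀ S, (Dfn1 F S ∧ S ∈ V) ↔ ∃ k, T k = S := by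
  have hc : {S : Set M | Dfn1 F S ∧ S ∈ V}.Countable := by
    refine ((countable_dfn (F := F)).preimage_of_injOn
      (f := fun S : Set M => fun v : ℕ → M => v 0 ∈ S) ?_).mono fun S hS => hS.1
    intro S _ T _ hST
    ext x
    exact iff_of_eq (congrFun hST fun _ => x)
  obtain ⟨T, hT⟩ := hc.exists_eq_range
    ⟨Set.univ, (Dfn.const True).congr fun v => by simp, univ_mem⟩
  exact ⟨T, fun S => by rw [← Set.mem_range, ← hT]; rfl⟩

theorem coe_mem_locus {T : ℕ → Set M} (hT : ∀ S, (Dfn1 F S ∧ S ∈ V) ↔ ∃ k, T k = S) {x : ℕ → M}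
    (hx : ∀ k, ∀ᶠ i in hyperfilter ℕ, x i ∈ T k) : (x : Star M) ∈ locus F V := by
  intro S hS hV
  obtain ⟨k, rfl⟩ := (hT S).1 ⟨hS, hV⟩
  change ∀ᶠ i in (hyperfilter ℕ : Filter ℕ), _
  filter_upwards [hx k, rep_coe x] with i h1 h2
  rwa [h2]

/-- Compactness: counterexamples on every definable set of `V` would be gathered by saturation into
a counterexample in the locus. Since `B` may depend on the index, parameters from the ultrapower are
allowed. -/
theorem exists_mem_of_forall_locus (B : ℕ → M → M → M → Prop)
    (hB : ∀ x ∈ locus F V, ∀ y ∈ locus F V, ∀ z ∈ locus F V,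
      ∀ᶠ i in hyperfilter ℕ, B i (rep x i) (rep y i) (rep z i)) :
    ∃ S ∈ V, Dfn1 F S ∧
      ∀ᶠ i in hyperfilter ℕ, ∀ x ∈ S, ∀ y ∈ S, ∀ z ∈ S, B i x y z := by
  by_contra! hcon
  obtain ⟨T, hT⟩ := exists_enum_dfn1 F V
  have hTk : ∀ k, Dfn1 F (T k) ∧ T k ∈ V := fun k => (hT _).2 ⟨k, rfl⟩
  obtain ⟨y0, -⟩ := V.nonempty_of_mem (hTk 0).2
  have : Nonempty M := ⟨y0⟩
  have hI : ∀ n, {x | ∀ k ≤ n, x ∈ T k} ∈ V := fun n => by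
    have : ∀ᶠ x in V, ∀ k ∈ Set.Iic n, x ∈ T k :=
      (Set.finite_Iic n).eventually_all.2 fun k _ => (hTk k).2
    exact this
  obtain ⟨y, hy⟩ := saturation (β := M × M × M)
    (fun k i y => y.1 ∈ T k ∧ y.2.1 ∈ T k ∧ y.2.2 ∈ T k ∧ ¬ B i y.1 y.2.1 y.2.2) fun n => by
      have h := hcon _ (hI n) (Dfn.forall_le (fun k => (hTk k).1) n)
      filter_upwards [h] with i hi
      obtain ⟨x, hx, y, hy, z, hz, hxyz⟩ := hi
      exact ⟨(x, y, z), fun k hk => ⟨hx k hk, hy k hk, hz k hk, hxyz⟩⟩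
  have hB' := hB _ (coe_mem_locus hT fun k => (hy k).mono fun i hi => hi.1)
    _ (coe_mem_locus hT fun k => (hy k).mono fun i hi => hi.2.1)
    _ (coe_mem_locus hT fun k => (hy k).mono fun i hi => hi.2.2.1)
  obtain ⟨i, h1, h2, h3, h4, h5⟩ := (hB'.and ((hy 0).and ((rep_coe fun i => (y i).1).and
    ((rep_coe fun i => (y i).2.1).and (rep_coe fun i => (y i).2.2))))).exists
  rw [h3, h4, h5] at h1
  exact h2.2.2.2 h1

theorem exists_convex_mem_subset (hW : TameSets F) {S : Set M} (hS : Dfn1 F S) (hV : S ∈ V) :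
    ∃ C ∈ V, Dfn1 F C ∧ C.OrdConnected ∧ C ⊆ S := by
  obtain ⟨P, hP, hPS⟩ := exists_convexPartition_single hW hS
  have h : ⋃₀ P ∈ V := by
    rw [hP.isPartition.sUnion_eq_univ]
    exact univ_mem
  obtain ⟨C, hC, hCV⟩ := (Ultrafilter.finite_sUnion_mem_iff hP.finite).1 h
  refine ⟨C, hCV, hP.dfn C hC, hP.convex C hC, (hPS C hC).resolve_right fun hd => ?_⟩
  obtain ⟨x, hx⟩ := V.nonempty_of_mem (inter_mem hCV hV)
  exact Set.disjoint_left.1 hd hx.1 hx.2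

theorem ordConnected_locus (hW : TameSets F) : (locus F V).OrdConnected := by
  refine ⟨fun x hx y hy z hz S hS hV => ?_⟩
  obtain ⟨C, hCV, hC, hconv, hCS⟩ := exists_convex_mem_subset hW hS hV
  have h1 := (le_iff_rep x z).1 hz.1
  have h2 := (le_iff_rep z y).1 hz.2
  change ∀ᶠ i in (hyperfilter ℕ : Filter ℕ), _
  filter_upwards [hx C hC hCV, hy C hC hCV, h1, h2] with i hi1 hi2 hi3 hi4
  exact hCS (hconv.out hi1 hi2 ⟨hi3, hi4⟩)

end SameType

/-! ### Positions relative to a point, and relations on the ultrapower. -/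

/-- The position of `f x` relative to `f w`, where `R x y` says that `f x ≤ f y`. -/
def col {N : Type*} (R : N → N → Prop) (w x : N) : Prop × Prop := (R x w, R w x)

/-- The end point of a chain of maximal length works: a later change of color would lengthen the
chain. -/
theorem Alt.exists_max {N κ : Type*} [LinearOrder N] {c : N → κ} {X : Set N} {n : ℕ}
    (hn : ∀ x, ¬ Alt c X n x) (hX : X.Nonempty) :
    ∃ b ∈ X, ∀ x ∈ X, b ≤ x → c x = c b := by
  classical
  have hex : ∃ n, ∀ x, ¬ Alt c X n x := ⟨n, hn⟩
  obtain ⟨x0, hx0⟩ := hX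
  obtain ⟨m, hm⟩ : ∃ m, Nat.find hex = m + 1 :=
    Nat.exists_eq_succ_of_ne_zero fun h => by
      have := Nat.find_spec hex x0
      rw [h] at this
      exact this hx0
  have hlt := Nat.find_min hex (m := m) (by omega)
  push Not at hlt
  obtain ⟨b, hb⟩ := hlt
  refine ⟨b, hb.mem, fun x hx hbx => ?_⟩
  by_contra hne
  have hspec := Nat.find_spec hex x
  rw [hm] at hspec
  rcases hbx.eq_or_lt with rfl | hlt
  · exact hne rfl
  · exact hspec ⟨hx, b, hlt, hb, Ne.symm hne⟩

section StarRelations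

variable {M : Type*}

theorem star_exists {p : ℕ → M → Prop} :
    (∀ᶠ i in hyperfilter ℕ, ∃ y, p i y) ↔
      ∃ y : Star M, ∀ᶠ i in hyperfilter ℕ, p i (rep y i) := by
  constructor
  · intro h
    obtain ⟨y0⟩ : Nonempty M := by
      obtain ⟨i, y, _⟩ := h.exists
      exact ⟨y⟩
    classical
    refine ⟨((fun i => if hi : ∃ y, p i y then hi.choose else y0 : ℕ → M) : Star M), ?_⟩
    filter_upwards [h, rep_coe fun i => if hi : ∃ y, p i y then hi.choose else y0] with i h1 h2
    rw [h2, dif_pos h1]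
    exact h1.choose_spec
  · rintro ⟨y, hy⟩
    exact hy.mono fun i hi => ⟨_, hi⟩

theorem star2_trans {F : M → M → Prop} (htr : ∀ x y z, F x y → F y z → F x z) {x y z : Star M}
    (h : star2 F x y) (h' : star2 F y z) : star2 F x z := by
  filter_upwards [h, h'] with i h1 h2 using htr _ _ _ h1 h2

theorem star2_refl {F : M → M → Prop} (h : ∀ x, F x x) (x : Star M) : star2 F x x :=
  Eventually.of_forall fun _ => h _

theorem star2_symm {e : M → M → Prop} (h : ∀ x y, e x y → e y x) {x y : Star M}
    (h' : star2 e x y) : star2 e y x :=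
  h'.mono fun _ => h _ _

theorem star2_not {e : M → M → Prop} (x y : Star M) :
    star2 (fun x y => ¬ e x y) x y ↔ ¬ star2 e x y :=
  Ultrafilter.eventually_not

/-- A color is a pair of truth values, so colors that differ in the ultrapower differ at almost
every index. -/
theorem alt_star [LinearOrder M] {F : M → M → Prop} {w : Star M} {n : ℕ} {x : Star M}
    (h : Alt (col (star2 F) w) Set.univ n x) :
    ∀ᶠ i in hyperfilter ℕ, Alt (col F (rep w i)) Set.univ n (rep x i) := by
  induction n generalizing x with
  | zero => exact Eventually.of_forall fun _ => trivial
  | succ n ih =>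
    obtain ⟨_, y, hyx, hy, hne⟩ := h
    have hne' : ∀ᶠ i in hyperfilter ℕ,
        col F (rep w i) (rep y i) ≠ col F (rep w i) (rep x i) := by
      refine Ultrafilter.eventually_not.2 fun h => hne ?_
      refine Prod.ext (propext ⟨fun h' => ?_, fun h' => ?_⟩)
        (propext ⟨fun h' => ?_, fun h' => ?_⟩) <;>
      · refine (h.and h').mono fun i hi => ?_
        have h1 := iff_of_eq (congrArg Prod.fst hi.1)
        have h2 := iff_of_eq (congrArg Prod.snd hi.1)
        have h3 := hi.2
        simp only [col] at h1 h2
        tauto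
    filter_upwards [(lt_iff_rep y x).1 hyx, ih hy, hne'] with i h1 h2 h3
    exact ⟨trivial, _, h1, h2, h3⟩

theorem star2_convex [LinearOrder M] {E : Setoid M} (hE : IsConvexEquiv E) {a x y z : Star M}
    (hx : star2 E a x) (hz : star2 E a z) (hxy : x ≤ y) (hyz : y ≤ z) : star2 E a y := by
  rw [le_iff_rep] at hxy hyz
  filter_upwards [hx, hz, hxy, hyz] with i h1 h2 h3 h4
  exact E.symm' ((hE (rep a i)).out (E.symm' h1) (E.symm' h2) ⟨h3, h4⟩)

end StarRelations

/-! ### Refining a convex equivalence relation near a type. -/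

section Refinement

variable {M : Type*} [LinearOrder M] {F : M → M → Prop} {V : Ultrafilter M}

/-- The elements `x ≥ a` of the locus that are `e`-equivalent to `a`. -/
def ray (F : M → M → Prop) (V : Ultrafilter M) (e : M → M → Prop) (a : Star M) : Set (Star M) :=
  {x | x ∈ locus F V ∧ star2 e a x ∧ a ≤ x}

/-- A bound for the number of changes of the position of `f x` relative to `f a`, for `x ≥ a` in
the `e`-class of `a` in the locus. -/
def ChainBound (F : M → M → Prop) (V : Ultrafilter M) (e : M → M → Prop) (n : ℕ) : Prop :=
  ∀ a ∈ locus F V, ∀ x, ¬ Alt (col (star2 F) a) (ray F V e a) n x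

/-- By homogeneity, the behavior to the right of one realization of the type is shared by all. -/
theorem eventually_ray_of_eventually_ray {q e : M → M → Prop} (hq : Dfn2 F q) (he : Dfn2 F e)
    {a a' : Star M} (ha : a ∈ locus F V) (ha' : a' ∈ locus F V)
    (h : ∃ b ∈ ray F V e a, ∀ x ∈ ray F V e a, b ≤ x → star2 q x a) :
    ∃ b ∈ ray F V e a', ∀ x ∈ ray F V e a', b ≤ x → star2 q x a' := by
  obtain ⟨b, ⟨hbP, hbE, hb⟩, hx⟩ := h
  obtain ⟨b', hs⟩ := (sameType_of_mem_locus ha ha').exists_cons b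
  refine ⟨b', ⟨hs.mem_locus (j := 0) hbP, (hs.star2_iff he 1 0).1 hbE, (hs.le_iff 1 0).1 hb⟩, ?_⟩
  rintro x' ⟨hxP', hxE', hax'⟩ hbx'
  obtain ⟨x, hs'⟩ := hs.symm.exists_cons x'
  exact (hs'.star2_iff hq 0 2).2 (hx x ⟨hs'.mem_locus (j := 0) hxP', (hs'.star2_iff he 2 0).1 hxE',
    (hs'.le_iff 2 0).1 hax'⟩ ((hs'.le_iff 1 0).1 hbx'))

theorem final_position (htr : ∀ x y z, F x y → F y z → F x z)
    {E : Setoid M} (hEd : Dfn2 F E) {n : ℕ} (hn : ChainBound F V E n) :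
    (∀ a ∈ locus F V, ∃ b ∈ ray F V E a, ∀ x ∈ ray F V E a, b ≤ x → ¬ star2 F x a) ∨
    (∀ a ∈ locus F V, ∃ b ∈ ray F V E a, ∀ x ∈ ray F V E a, b ≤ x → ¬ star2 F a x) ∨
    (∀ a ∈ locus F V, ∀ b ∈ locus F V, star2 E a b → star2 F a b) := by
  have hmax : ∀ a ∈ locus F V, ∃ b ∈ ray F V E a, ∀ x ∈ ray F V E a, b ≤ x →
      col (star2 F) a x = col (star2 F) a b := fun a ha =>
    Alt.exists_max (hn a ha) ⟨a, ha, star2_refl E.refl a, le_rfl⟩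
  by_cases h1 : ∃ a ∈ locus F V, ∃ b ∈ ray F V E a, ∀ x ∈ ray F V E a, b ≤ x → ¬ star2 F x a
  · obtain ⟨a, ha, h⟩ := h1
    left
    intro a' ha'
    simp only [← star2_not] at h ⊢
    exact eventually_ray_of_eventually_ray (Dfn.rel' 0 1).not hEd ha ha' h
  by_cases h2 : ∃ a ∈ locus F V, ∃ b ∈ ray F V E a, ∀ x ∈ ray F V E a, b ≤ x → ¬ star2 F a x
  · obtain ⟨a, ha, h⟩ := h2
    right; left
    intro a' ha'
    have hsw : ∀ x y : Star M, ¬ star2 F x y ↔ star2 (fun x y => ¬ F y x) y x := fun x y =>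
      (star2_not (e := fun x y => F y x) y x).symm
    simp only [hsw] at h ⊢
    exact eventually_ray_of_eventually_ray (q := fun x y => ¬ F y x) (Dfn.rel' 1 0).not hEd ha ha' h
  right; right
  have hcst : ∀ a ∈ locus F V, ∃ b ∈ ray F V E a, ∀ x ∈ ray F V E a, b ≤ x →
      star2 F x a ∧ star2 F a x := by
    intro a ha
    obtain ⟨b, hb, hbx⟩ := hmax a ha
    have hx : ∀ x ∈ ray F V E a, b ≤ x → (star2 F x a ↔ star2 F b a) ∧
        (star2 F a x ↔ star2 F a b) := fun x hx hbx' =>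
      ⟨iff_of_eq (congrArg Prod.fst (hbx x hx hbx')), iff_of_eq (congrArg Prod.snd (hbx x hx hbx'))⟩
    have hb1 : star2 F b a := by
      by_contra hc
      exact h1 ⟨a, ha, b, hb, fun x h h' => by rwa [(hx x h h').1]⟩
    have hb2 : star2 F a b := by
      by_contra hc
      exact h2 ⟨a, ha, b, hb, fun x h h' => by rwa [(hx x h h').2]⟩
    exact ⟨b, hb, fun x h h' => ⟨(hx x h h').1.2 hb1, (hx x h h').2.2 hb2⟩⟩
  intro a ha b hb hab
  obtain ⟨c, ⟨hcP, hcE, hca⟩, hc⟩ := hcst a ha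
  obtain ⟨d, ⟨hdP, hdE, hdb⟩, hd⟩ := hcst b hb
  have hEt : ∀ {x y z : Star M}, star2 E x y → star2 E y z → star2 E x z :=
    fun h h' => star2_trans (F := E) (fun _ _ _ => E.trans') h h'
  have hEs : ∀ {x y : Star M}, star2 E x y → star2 E y x :=
    fun h => star2_symm (e := E) (fun _ _ => E.symm') h
  -- Far enough to the right, one point has the same value as both `a` and `b`.
  have hm : max c d ∈ locus F V ∧ star2 E a (max c d) := by
    rcases max_choice c d with h | h <;> rw [h]
    exacts [⟨hcP, hcE⟩, ⟨hdP, hEt hab hdE⟩]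
  exact star2_trans htr
    (hc _ ⟨hm.1, hm.2, hca.trans (le_max_left _ _)⟩ (le_max_left _ _)).2
    (hd _ ⟨hm.1, hEt (hEs hab) hm.2, hdb.trans (le_max_right _ _)⟩ (le_max_right _ _)).1

/-- `x` lies below an element `y` of the `e`-class of `a` in the locus with `f y ≤ f a`. -/
def Below (F : M → M → Prop) (V : Ultrafilter M) (e : M → M → Prop) (a x : Star M) : Prop :=
  ∃ y ∈ locus F V, star2 e a y ∧ x ≤ y ∧ star2 F y a

/-- `b` and `c` witness that `Below` is not monotone at `a`. -/
def Nested (F : M → M → Prop) (V : Ultrafilter M) (e : M → M → Prop) (a b c : Star M) : Prop :=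
  c ∈ locus F V ∧ star2 e a c ∧ a < b ∧ b < c ∧ star2 F c a ∧
    ∀ y ∈ locus F V, star2 e a y → c ≤ y → ¬ star2 F y b

theorem exists_nested {e : M → M → Prop} (he : Dfn2 F e) {a a' b c : Star M}
    (ha : a ∈ locus F V) (ha' : a' ∈ locus F V) (h : Nested F V e a b c) :
    ∃ b' c', Nested F V e a' b' c' := by
  obtain ⟨hcP, hcE, hab, hbc, hca, hy⟩ := h
  obtain ⟨b', hs⟩ := (sameType_of_mem_locus ha ha').exists_cons b
  obtain ⟨c', hs⟩ := hs.exists_cons c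
  refine ⟨b', c', hs.mem_locus (j := 0) hcP, (hs.star2_iff he 2 0).1 hcE, (hs.lt_iff 2 1).1 hab,
    (hs.lt_iff 1 0).1 hbc, (hs.star2_iff Dfn.rel 0 2).1 hca, fun y' hyP' hyE' hcy' hF => ?_⟩
  obtain ⟨y, hs'⟩ := hs.symm.exists_cons y'
  exact hy y (hs'.mem_locus (j := 0) hyP') ((hs'.star2_iff he 3 0).1 hyE')
    ((hs'.le_iff 1 0).1 hcy') ((hs'.star2_iff Dfn.rel 0 2).1 hF)

/-- By homogeneity the configuration can be repeated from `c`, giving `s 0 < B (s 0) < s 1 < B (s 1)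
< …`. Relative to `f (s n)`, the values at the earlier `s k` are at least as large while those at `B
(s k)` are smaller, so there are `2 * n` changes of position; `n = N` is too many. -/
theorem not_nested (hrefl : ∀ x, F x x) (htr : ∀ x y z, F x y → F y z → F x z)
    {E : Setoid M} (hEd : Dfn2 F E) {N : ℕ}
    (hN : ∀ w x : Star M, ¬ Alt (col (star2 F) w) Set.univ N x) {a b c : Star M}
    (ha : a ∈ locus F V) : ¬ Nested F V E a b c := by
  intro h
  have hex : ∀ x, ∃ b c, x ∈ locus F V → Nested F V E x b c := fun x => by
    by_cases hx : x ∈ locus F V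
    · obtain ⟨b, c, h⟩ := exists_nested hEd ha hx h
      exact ⟨b, c, fun _ => h⟩
    · exact ⟨x, x, fun h => absurd h hx⟩
  choose B C hBC using hex
  set s : ℕ → Star M := fun n => C^[n] a with hs
  have hs1 : ∀ n, s (n + 1) = C (s n) := fun n => Function.iterate_succ_apply' C n a
  have hsP : ∀ n, s n ∈ locus F V := fun n => by
    induction n with
    | zero => exact ha
    | succ n ih => rw [hs1]; exact (hBC _ ih).1
  have hnest : ∀ n, Nested F V E (s n) (B (s n)) (s (n + 1)) := fun n => by
    rw [hs1]
    exact hBC _ (hsP n)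
  have hmono : StrictMono s :=
    strictMono_nat_of_lt_succ fun n => (hnest n).2.2.1.trans (hnest n).2.2.2.1
  have hF : ∀ k m, k ≤ m → star2 F (s m) (s k) ∧ star2 E (s k) (s m) := by
    intro k m hkm
    induction m, hkm using Nat.le_induction with
    | base => exact ⟨star2_refl hrefl _, star2_refl E.refl _⟩
    | succ m _ ih =>
      exact ⟨star2_trans htr (hnest m).2.2.2.2.1 ih.1,
        star2_trans (F := E) (fun _ _ _ => E.trans') ih.2 (hnest m).2.1⟩
  have halt : ∀ n k, k ≤ n → Alt (col (star2 F) (s n)) Set.univ (2 * k) (s k) := by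
    intro n k hk
    induction k with
    | zero => trivial
    | succ k ih =>
      have hB : ¬ star2 F (s n) (B (s k)) :=
        (hnest k).2.2.2.2.2 _ (hsP n) (hF k n (by omega)).2 (hmono.monotone hk)
      have hne : ∀ m ≤ n, col (star2 F) (s n) (s m) ≠ col (star2 F) (s n) (B (s k)) :=
        fun m hm heq => hB ((iff_of_eq (congrArg Prod.snd heq)).1 (hF m n hm).1)
      exact ⟨trivial, B (s k), (hnest k).2.2.2.1,
        ⟨trivial, s k, (hnest k).2.2.1, ih (by omega), hne k (by omega)⟩, (hne (k + 1) hk).symm⟩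
  obtain ⟨x, hx⟩ := (halt N N le_rfl).exists_of_le (m := N) (by omega)
  exact hN _ x hx

/-- The locus is not definable, so `Below` is not either. With `S` in its place, witnesses still
cannot lie beyond a point `b` of the locus, which forces them back into the locus by convexity. -/
theorem exists_bounding_set {e : M → M → Prop} (he : Dfn2 F e)
    (hinc : ∀ a ∈ locus F V, ∃ b ∈ ray F V e a, ∀ x ∈ ray F V e a, b ≤ x → ¬ star2 F x a) :
    ∃ S ∈ V, Dfn1 F S ∧ ∀ a ∈ locus F V, ∃ b ∈ ray F V e a, ∀ y ∈ star1 S,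
      star2 e a y → b ≤ y → ¬ star2 F y a := by
  rcases (locus F V).eq_empty_or_nonempty with hP | ⟨a, ha⟩
  · exact ⟨Set.univ, univ_mem, (Dfn.const True).congr fun v => by simp,
      fun a ha => by simp [hP] at ha⟩
  obtain ⟨b, hb, hbx⟩ := hinc a ha
  obtain ⟨S, hSV, hS, hev⟩ := exists_mem_of_forall_locus (F := F) (V := V)
    (fun i x _ _ => e (rep a i) x → rep b i ≤ x → ¬ F x (rep a i)) (by
      intro x hx _ _ _ _
      refine Ultrafilter.eventually_imp.2 fun h1 => Ultrafilter.eventually_imp.2 fun h2 =>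
        Ultrafilter.eventually_not.2 ?_
      rw [← le_iff_rep] at h2
      exact hbx x ⟨hx, h1, hb.2.2.trans h2⟩ h2)
  have hy : ∀ y ∈ star1 S, star2 e a y → b ≤ y → ¬ star2 F y a := by
    intro y hyS hyE hby
    rw [← star2_not]
    rw [le_iff_rep] at hby
    change ∀ᶠ i in (hyperfilter ℕ : Filter ℕ), _
    filter_upwards [hev, hyS, hyE, hby] with i h1 h2 h3 h4
    exact h1 _ h2 _ h2 _ h2 h3 h4
  refine ⟨S, hSV, hS, fun a' ha' => ?_⟩
  obtain ⟨hbP, hbE, hab⟩ := hb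
  obtain ⟨b', hs⟩ := (sameType_of_mem_locus ha ha').exists_cons b
  refine ⟨b', ⟨hs.mem_locus (j := 0) hbP, (hs.star2_iff he 1 0).1 hbE, (hs.le_iff 1 0).1 hab⟩,
    fun y' hyS' hyE' hby' hF => ?_⟩
  obtain ⟨y, hs'⟩ := hs.symm.exists_cons y'
  exact hy y ((hs'.star1_iff hS 0).1 hyS') ((hs'.star2_iff he 2 0).1 hyE')
    ((hs'.le_iff 1 0).1 hby') ((hs'.star2_iff Dfn.rel 0 2).1 hF)

/-- The restriction to `C` of a relation that is an equivalence relation on `C`, extended by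
equality. -/
def restrictSetoid (C : Set M) (e : M → M → Prop)
    (hs : ∀ x ∈ C, ∀ y ∈ C, e x y → e y x)
    (ht : ∀ x ∈ C, ∀ y ∈ C, ∀ z ∈ C, e x y → e y z → e x z) : Setoid M where
  r x y := x = y ∨ (x ∈ C ∧ y ∈ C ∧ e x y)
  iseqv :=
    { refl := fun _ => Or.inl rfl
      symm := by
        rintro x y (rfl | ⟨h1, h2, h3⟩)
        exacts [Or.inl rfl, Or.inr ⟨h2, h1, hs x h1 y h2 h3⟩]
      trans := by
        rintro x y z (rfl | ⟨h1, h2, h3⟩) (rfl | ⟨h4, h5, h6⟩)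
        · exact Or.inl rfl
        · exact Or.inr ⟨h4, h5, h6⟩
        · exact Or.inr ⟨h1, h2, h3⟩
        · exact Or.inr ⟨h1, h5, ht x h1 y h2 z h5 h3 h6⟩ }

/-- On the locus, `E'` identifies `E`-equivalent points with the same `Below` set. By `not_nested`
these sets grow with the point, so for `a ≤ b` this reduces to `Below F V E a b`, which is convex in
`b` and agrees on the locus with a definable relation. -/
theorem exists_refinement (hW : TameSets F) (htot : ∀ x y, F x y ∨ F y x)
    (htr : ∀ x y z, F x y → F y z → F x z) {N : ℕ}
    (hN : ∀ w x : Star M, ¬ Alt (col (star2 F) w) Set.univ N x)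
    {E : Setoid M} (hE : IsConvexEquiv E) (hEd : Dfn2 F E) {n : ℕ}
    (hn : ChainBound F V E (n + 1))
    (hinc : ∀ a ∈ locus F V, ∃ b ∈ ray F V E a, ∀ x ∈ ray F V E a, b ≤ x → ¬ star2 F x a) :
    ∃ E' : Setoid M, IsConvexEquiv E' ∧ Dfn2 F E' ∧ E' ≤ E ∧ ChainBound F V E' n ∧
      ∃ S ∈ V, Dfn1 F S ∧ ∀ x ∈ S, ∀ y ∈ S, x < y → E x y → ¬ E' x y → ¬ F y x := by
  have hrefl : ∀ x, F x x := fun x => (htot x x).elim id id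
  have hEr : ∀ x : Star M, star2 E x x := star2_refl E.refl
  have hEt : ∀ {x y z : Star M}, star2 E x y → star2 E y z → star2 E x z :=
    fun h h' => star2_trans (F := E) (fun _ _ _ => E.trans') h h'
  have hEs : ∀ {x y : Star M}, star2 E x y → star2 E y x :=
    fun h => star2_symm (e := E) (fun _ _ => E.symm') h
  have hFt : ∀ {x y z : Star M}, star2 F x y → star2 F y z → star2 F x z :=
    fun h h' => star2_trans htr h h'
  have hconv := ordConnected_locus (F := F) (V := V) hW
  have mono_of_F : ∀ {a b z : Star M}, star2 E a b → star2 F b a → Below F V E b z →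
      Below F V E a z := fun hab hba ⟨y, hy, hE', hz, hF⟩ => ⟨y, hy, hEt hab hE', hz, hFt hF hba⟩
  have below_self : ∀ {a : Star M}, a ∈ locus F V → Below F V E a a := fun {a} ha =>
    ⟨a, ha, hEr a, le_rfl, star2_refl hrefl a⟩
  have mono : ∀ {a b z : Star M}, a ∈ locus F V → b ∈ locus F V → star2 E a b → a ≤ b →
      Below F V E a z → Below F V E b z := by
    rintro a b z ha hb hab hle ⟨c, hc, hac, hzc, hca⟩
    by_contra hcon
    have hnb : ∀ y ∈ locus F V, star2 E a y → c ≤ y → ¬ star2 F y b := fun y hy hay hcy hF =>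
      hcon ⟨y, hy, hEt (hEs hab) hay, hzc.trans hcy, hF⟩
    have hbc : b < c := by
      by_contra hlt
      exact hnb b hb hab (not_lt.1 hlt) (star2_refl hrefl b)
    rcases hle.eq_or_lt with rfl | hlt
    · exact hcon ⟨c, hc, hac, hzc, hca⟩
    · exact not_nested hrefl htr hEd hN ha ⟨hc, hac, hlt, hbc, hca, hnb⟩
  have anti : ∀ {a b z : Star M}, a ∈ locus F V → b ∈ locus F V → star2 E a b →
      Below F V E a b → Below F V E b z → Below F V E a z := by
    rintro a b z ha hb hab ⟨y, hy, hay, hby, hya⟩ hbz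
    exact mono_of_F hay hya (mono hb hy (hEt (hEs hab) hay) hby hbz)
  obtain ⟨S, hSV, hS, hSb⟩ := exists_bounding_set hEd hinc
  let below : M → M → Prop := fun a x => ∃ y, y ∈ S ∧ E a y ∧ x ≤ y ∧ F y a
  have hbelow : Dfn2 F below :=
    Dfn.ex (p := fun v => v 0 ∈ S ∧ E (v 1) (v 0) ∧ v 2 ≤ v 0 ∧ F (v 0) (v 1))
      (hS.and ((hEd.sub 1 0).and ((Dfn.le' 2 0).and (Dfn.rel' 0 1))))
  have below_iff : ∀ a ∈ locus F V, ∀ x ∈ locus F V, star2 below a x ↔ Below F V E a x := by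
    intro a ha x hx
    obtain ⟨b, ⟨hbP, _, _⟩, hb⟩ := hSb a ha
    have h1 : star2 below a x ↔ ∃ y ∈ star1 S, star2 E a y ∧ x ≤ y ∧ star2 F y a := by
      refine star_exists.trans (exists_congr fun y => ?_)
      simp only [eventually_and, ← le_iff_rep]
      rfl
    rw [h1]
    constructor
    · rintro ⟨y, hyS, hay, hxy, hya⟩
      have hyb : y < b := not_le.1 fun hby => hb y hyS hay hby hya
      exact ⟨y, hconv.out hx hbP ⟨hxy, hyb.le⟩, hay, hxy, hya⟩
    · rintro ⟨y, hy, h⟩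
      exact ⟨y, hy S hS hSV, h⟩
  let e : M → M → Prop := fun x y => E x y ∧ (x ≤ y → below x y) ∧ (y ≤ x → below y x)
  have hed : Dfn2 F e := hEd.and (((Dfn.le' 0 1).imp hbelow).and
    ((Dfn.le' 1 0).imp (hbelow.sub 1 0)))
  have e_iff : ∀ a ∈ locus F V, ∀ b ∈ locus F V, star2 e a b ↔
      star2 E a b ∧ ∀ z, Below F V E a z ↔ Below F V E b z := by
    intro a ha b hb
    have h1 : star2 e a b ↔ star2 E a b ∧ (a ≤ b → Below F V E a b) ∧
        (b ≤ a → Below F V E b a) := by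
      rw [← below_iff a ha b hb, ← below_iff b hb a ha, le_iff_rep, le_iff_rep]
      simp only [star2, e, eventually_and, Ultrafilter.eventually_imp]
    rw [h1]
    refine and_congr_right fun hab => ⟨fun h z => ?_, fun h => ?_⟩
    · rcases le_total a b with hle | hle
      · exact ⟨mono ha hb hab hle, anti ha hb hab (h.1 hle)⟩
      · exact ⟨anti hb ha (hEs hab) (h.2 hle), mono hb ha (hEs hab) hle⟩
    · exact ⟨fun _ => (h b).2 (below_self hb), fun _ => (h a).1 (below_self ha)⟩
  have e_iff_below : ∀ a ∈ locus F V, ∀ b ∈ locus F V, a ≤ b → (star2 e a b ↔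
      star2 E a b ∧ Below F V E a b) := by
    intro a ha b hb hab
    rw [e_iff a ha b hb]
    exact and_congr_right fun h => ⟨fun h' => (h' b).2 (below_self hb), fun h' z =>
      ⟨mono ha hb h hab, anti ha hb h h'⟩⟩
  obtain ⟨T, hTV, hT, hTe⟩ := exists_mem_of_forall_locus (F := F) (V := V)
    (fun _ x y z => e x x ∧ (e x y → e y x) ∧ (e x y → e y z → e x z) ∧
      (x ≤ y → y ≤ z → e x z → e x y) ∧ (x < y → E x y → F y x → e x y)) (by
      intro x hx y hy z hz
      simp only [eventually_and, Ultrafilter.eventually_imp,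
        ← le_iff_rep, ← lt_iff_rep]
      change star2 e x x ∧ (star2 e x y → star2 e y x) ∧
        (star2 e x y → star2 e y z → star2 e x z) ∧ (x ≤ y → y ≤ z → star2 e x z → star2 e x y) ∧
        (x < y → star2 E x y → star2 F y x → star2 e x y)
      refine ⟨(e_iff x hx x hx).2 ⟨hEr x, fun _ => Iff.rfl⟩, fun h => ?_, fun h h' => ?_,
        fun hxy hyz h => ?_, fun hxy hE' hF => ?_⟩
      · rw [e_iff x hx y hy] at h
        exact (e_iff y hy x hx).2 ⟨hEs h.1, fun z => (h.2 z).symm⟩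
      · rw [e_iff x hx y hy] at h
        rw [e_iff y hy z hz] at h'
        exact (e_iff x hx z hz).2 ⟨hEt h.1 h'.1, fun w => (h.2 w).trans (h'.2 w)⟩
      · rw [e_iff_below x hx z hz (hxy.trans hyz)] at h
        obtain ⟨w, hw, hxw, hzw, hF⟩ := h.2
        exact (e_iff_below x hx y hy hxy).2 ⟨star2_convex hE (hEr x) h.1 hxy hyz,
          w, hw, hxw, hyz.trans hzw, hF⟩
      · exact (e_iff_below x hx y hy hxy.le).2 ⟨hE', y, hy, hE', le_rfl, hF⟩)
  -- The property obtained does not depend on the index, so one index suffices.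
  obtain ⟨i, hTe⟩ := hTe.exists
  clear i
  obtain ⟨C, hCV, hC, hCc, hCT⟩ := exists_convex_mem_subset hW hT hTV
  have hCe := fun x hx y hy z hz => hTe x (hCT hx) y (hCT hy) z (hCT hz)
  let E' : Setoid M := restrictSetoid C e
    (fun x hx y hy => (hCe x hx y hy y hy).2.1) (fun x hx y hy z hz => (hCe x hx y hy z hz).2.2.1)
  have hE'e : ∀ a ∈ locus F V, ∀ b ∈ locus F V, star2 E' a b ↔ star2 e a b := by
    intro a ha b hb
    refine eventually_congr ?_
    filter_upwards [ha C hC hCV, hb C hC hCV] with i h1 h2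
    constructor
    · rintro (h | h)
      · rw [h]
        exact (hCe _ h2 _ h2 _ h2).1
      · exact h.2.2
    · exact fun h => Or.inr ⟨h1, h2, h⟩
  refine ⟨E', ?_, ?_, ?_, ?_, C, hCV, hC, ?_⟩
  · intro a
    refine ⟨?_⟩
    rintro x hx z hz y ⟨hxy, hyz⟩
    have hxz : E' x z := E'.trans' hx (E'.symm' hz)
    rcases hxz with rfl | ⟨hxC, hzC, hxz⟩
    · rwa [le_antisymm hyz hxy]
    · have hyC := hCc.out hxC hzC ⟨hxy, hyz⟩
      have hxy' : E' x y := Or.inr ⟨hxC, hyC, (hCe x hxC y hyC z hzC).2.2.2.1 hxy hyz hxz⟩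
      exact E'.trans' (E'.symm' hxy') hx
  · exact (Dfn.eq' 0 1).or ((hC.sub 0).and ((hC.sub 1).and hed))
  · rintro x y (rfl | h)
    exacts [E.refl _, h.2.2.1]
  · intro a ha x hx
    have hsub : ray F V E' a ⊆ ray F V E a := by
      rintro y ⟨hy, hay, hle⟩
      rw [hE'e a ha y hy, e_iff a ha y hy] at hay
      exact ⟨hy, hay.1, hle⟩
    obtain ⟨hxP, hax, hle⟩ := hx.mem
    rw [hE'e a ha x hxP, e_iff_below a ha x hxP hle] at hax
    obtain ⟨y, hy, hay, hxy, hya⟩ := hax.2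
    obtain ⟨b, hb, hbx⟩ := hinc a ha
    have halt := hx.mono hsub
    -- The chain ending at `x` extends inside the `E`-class: if `f x ≤ f a`, by a point far to the
    -- right, where `f` exceeds `f a`; otherwise by `y`, where `f y ≤ f a`.
    by_cases hxa : star2 F x a
    · have hm : max b y ∈ ray F V E a := by
        rcases max_choice b y with h | h <;> rw [h]
        exacts [hb, ⟨hy, hay, hle.trans hxy⟩]
      have hm' := hbx _ hm (le_max_left _ _)
      have hne : col (star2 F) a x ≠ col (star2 F) a (max b y) := fun h =>
        hm' ((iff_of_eq (congrArg Prod.fst h)).1 hxa)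
      have hxm : x ≤ max b y := hxy.trans (le_max_right _ _)
      exact hn a ha _ ⟨hm, x, lt_of_le_of_ne hxm fun h => hne (by rw [← h]), halt, hne⟩
    · have hne : col (star2 F) a x ≠ col (star2 F) a y := fun h =>
        hxa ((iff_of_eq (congrArg Prod.fst h)).2 hya)
      exact hn a ha y ⟨⟨hy, hay, hle.trans hxy⟩, x, lt_of_le_of_ne hxy fun h => hne (by rw [← h]),
        halt, hne⟩
  · exact fun x hx y hy hxy hE' hne hF =>
      hne (Or.inr ⟨hx, hy, (hCe x hx y hy y hy).2.2.2.2 hxy hE' hF⟩)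

end Refinement

/-! ### Calculus of order reversals. -/

section ReverseSeq

variable {X : Type w}

theorem reverseSeq_append (lt : X → X → Prop) (l : List (Setoid X)) (E : Setoid X) :
    reverseSeq lt (l ++ [E]) = reverseOn (reverseSeq lt l) E := by
  simp [reverseSeq]

theorem reverseSeq_flip (lt : X → X → Prop) (l : List (Setoid X)) (x y : X) :
    reverseSeq (fun x y => lt y x) l x y ↔ reverseSeq lt l y x := by
  induction l using List.reverseRecOn generalizing x y with
  | nil => rfl
  | append_singleton l E ih =>
    rw [reverseSeq_append, reverseSeq_append]
    have hE : E x y ↔ E y x := E.comm'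
    simp only [reverseOn, ih, hE]

theorem reverseSeq_iff_of_not (lt : X → X → Prop) {l : List (Setoid X)} {x y : X}
    (h : ∀ E ∈ l, ¬ E x y) : reverseSeq lt l x y ↔ lt x y := by
  induction l using List.reverseRecOn with
  | nil => rfl
  | append_singleton l E ih =>
    rw [reverseSeq_append]
    have hE := h E (by simp)
    simp only [reverseOn, hE, false_and, not_false_eq_true, true_and, false_or]
    exact ih fun E hE => h E (by simp [hE])

theorem reverseSeq_map_congr {ι : Type*} (lt : X → X → Prop) (l : List ι) {G G' : ι → Setoid X}
    {x y : X} (h : ∀ i ∈ l, G i x y ↔ G' i x y) :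
    (reverseSeq lt (l.map G) x y ↔ reverseSeq lt (l.map G') x y) ∧
      (reverseSeq lt (l.map G) y x ↔ reverseSeq lt (l.map G') y x) := by
  induction l using List.reverseRecOn with
  | nil => exact ⟨Iff.rfl, Iff.rfl⟩
  | append_singleton l i ih =>
    obtain ⟨h1, h2⟩ := ih fun j hj => h j (by simp [hj])
    have hi := h i (by simp)
    have hi' : G i y x ↔ G' i y x := (G i).comm'.trans (hi.trans (G' i).comm')
    simp only [List.map_append, List.map_cons, List.map_nil, reverseSeq_append, reverseOn, h1, h2,
      hi, hi', and_self]

theorem reverseSeq_replicate_bot (lt : X → X → Prop) (hlt : ∀ x, ¬ lt x x) (k : ℕ)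
    (l : List (Setoid X)) : reverseSeq lt (List.replicate k ⊥ ++ l) = reverseSeq lt l := by
  induction k with
  | zero => rfl
  | succ k ih =>
    rw [← ih, List.replicate_succ]
    have : reverseOn lt ⊥ = lt := by
      funext x y
      by_cases h : x = y
      · subst h
        simp [reverseOn, hlt]
      · simp [reverseOn, h]
    simp [reverseSeq, this]

theorem isConvexEquiv_bot [LinearOrder X] : IsConvexEquiv (⊥ : Setoid X) := fun _ =>
  Set.ordConnected_singleton

theorem isConvexEquiv_top [LinearOrder X] : IsConvexEquiv (⊤ : Setoid X) := fun _ =>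
  Set.ordConnected_univ

end ReverseSeq

/-! ### Induction on the number of position changes. -/

section Good

variable {M : Type w} [LinearOrder M] {F : M → M → Prop} {V : Ultrafilter M}

/-- On some set in the ultrafilter, `f` is increasing on `E`-classes with respect to the order
obtained from `lt` by a sequence of reversals. -/
def Good (F : M → M → Prop) (V : Ultrafilter M) (E : Setoid M) (lt : M → M → Prop) : Prop :=
  ∃ Es : List (Setoid M), (∀ E' ∈ Es, IsConvexEquiv E' ∧ Dfn2 F E' ∧ E' ≤ E) ∧
    Es.Pairwise (· ≤ ·) ∧ ∃ S ∈ V, Dfn1 F S ∧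
      ∀ x ∈ S, ∀ y ∈ S, E x y → reverseSeq lt Es x y → F x y

/-- Reversing inside the classes of `E` at the end cancels the reversal of `lt`, as only pairs in
one `E`-class are compared. -/
theorem Good.flip {E : Setoid M} (hE : IsConvexEquiv E) (hEd : Dfn2 F E) {lt : M → M → Prop}
    (h : Good F V E lt) : Good F V E (fun x y => lt y x) := by
  obtain ⟨Es, h1, h2, S, hSV, hS, h3⟩ := h
  refine ⟨Es ++ [E], ?_, ?_, S, hSV, hS, fun x hx y hy hxy hlt => h3 x hx y hy hxy ?_⟩
  · intro E' hE'
    rw [List.mem_append, List.mem_singleton] at hE'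
    rcases hE' with h | rfl
    exacts [h1 E' h, ⟨hE, hEd, le_rfl⟩]
  · rw [List.pairwise_append]
    refine ⟨h2, List.pairwise_singleton _ _, fun E' hE' E'' hE'' => ?_⟩
    rw [List.mem_singleton.1 hE'']
    exact (h1 E' hE').2.2
  · rw [reverseSeq_append] at hlt
    rcases hlt with h | h
    · exact (reverseSeq_flip lt Es y x).1 h.2
    · exact absurd hxy h.1

/-- Reversals along relations finer than `E'` leave the order between `E'`-classes unchanged. -/
theorem Good.of_refinement {E E' : Setoid M} {lt : M → M → Prop} (hEE : E' ≤ E)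
    (h : Good F V E' lt) {S : Set M} (hSV : S ∈ V) (hS : Dfn1 F S)
    (hSE : ∀ x ∈ S, ∀ y ∈ S, lt x y → E x y → ¬ E' x y → F x y) : Good F V E lt := by
  obtain ⟨Es, h1, h2, T, hTV, hT, h3⟩ := h
  refine ⟨Es, fun E'' h => ⟨(h1 E'' h).1, (h1 E'' h).2.1, (h1 E'' h).2.2.trans hEE⟩, h2, S ∩ T,
    inter_mem hSV hTV, hS.inter hT, fun x hx y hy hxy hlt => ?_⟩
  by_cases hxy' : E' x y
  · exact h3 x hx.2 y hy.2 hxy' hlt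
  · rw [reverseSeq_iff_of_not lt fun E'' h h' => hxy' ((h1 E'' h).2.2 h')] at hlt
    exact hSE x hx.1 y hy.1 hlt hxy hxy'

theorem TameSets.swap (hW : TameSets F) : TameSets fun x y => F y x := fun S hS => hW S hS.swap

theorem locus_swap : locus (fun x y => F y x) V = locus F V := by
  ext x
  exact ⟨fun h S hS => h S hS.swap, fun h S hS => h S hS.swap⟩

theorem Alt.comp_injective {N κ κ' : Type*} [LinearOrder N] {c : N → κ} {c' : N → κ'} {X : Set N}
    (hc : ∀ x y, c x = c y → c' x = c' y) {n : ℕ} {x : N} (h : Alt c' X n x) : Alt c X n x := by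
  induction n generalizing x with
  | zero => exact h
  | succ n ih =>
    obtain ⟨hx, y, hyx, hy, hne⟩ := h
    exact ⟨hx, y, hyx, ih hy, fun h => hne (hc _ _ h)⟩

theorem alt_swap {N : Type*} [LinearOrder N] {R : N → N → Prop} {w : N} {X : Set N} {n : ℕ} {x : N}
    (h : Alt (col (fun x y => R y x) w) X n x) : Alt (col R w) X n x :=
  h.comp_injective fun _ _ h => Prod.ext (congrArg Prod.snd h) (congrArg Prod.fst h)

theorem ray_swap (e : M → M → Prop) (a : Star M) :
    ray (fun x y => F y x) V e a = ray F V e a := by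
  simp only [ray, locus_swap]

theorem ChainBound.swap {e : M → M → Prop} {n : ℕ} (h : ChainBound F V e n) :
    ChainBound (fun x y => F y x) V e n := by
  intro a ha x hx
  rw [locus_swap] at ha
  rw [ray_swap] at hx
  exact h a ha x (alt_swap hx)

theorem good_of_constant {E : Setoid M} {lt : M → M → Prop}
    (h : ∀ a ∈ locus F V, ∀ b ∈ locus F V, star2 E a b → star2 F a b) : Good F V E lt := by
  obtain ⟨S, hSV, hS, hev⟩ := exists_mem_of_forall_locus (F := F) (V := V)
    (fun _ x y _ => E x y → F x y)
    fun x hx y hy _ _ => Ultrafilter.eventually_imp.2 fun h' => h x hx y hy h'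
  obtain ⟨_, hi⟩ := hev.exists
  exact ⟨[], by simp, List.Pairwise.nil, S, hSV, hS, fun x hx y hy hxy _ => hi x hx y hy y hy hxy⟩

theorem good_of_chainBound (hW : TameSets F) (htot : ∀ x y, F x y ∨ F y x)
    (htr : ∀ x y z, F x y → F y z → F x z) {N : ℕ}
    (hN : ∀ w x : Star M, ¬ Alt (col (star2 F) w) Set.univ N x) (n : ℕ)
    {E : Setoid M} (hE : IsConvexEquiv E) (hEd : Dfn2 F E) (hn : ChainBound F V E n) :
    Good F V E (· < ·) := by
  induction n generalizing E with
  | zero =>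
    exact good_of_constant fun a ha => (hn a ha a ⟨ha, star2_refl E.refl a, le_rfl⟩).elim
  | succ n ih =>
    rcases final_position htr hEd hn with h | h | h
    · obtain ⟨E', h1, h2, h3, h4, S, hSV, hS, h5⟩ :=
        exists_refinement hW htot htr hN hE hEd hn h
      exact (ih h1 h2 h4).of_refinement h3 hSV hS
        fun x hx y hy hlt hxy hne => (htot x y).resolve_right (h5 x hx y hy hlt hxy hne)
    · simp only [← locus_swap (F := F), ← ray_swap (F := F)] at h
      obtain ⟨E', h1, h2, h3, h4, S, hSV, hS, h5⟩ :=
        exists_refinement hW.swap (fun x y => htot y x) (fun x y z h h' => htr z y x h' h)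
          (fun w x h => hN w x (alt_swap h)) hE hEd.swap hn.swap h
      have hd : Dfn2 F E' := h2.swap
      -- Between `E'`-classes `f` is decreasing for `<`, so the refinement is applied to `>`.
      -- Passing to `>` appends `E'` to the sequence, and passing back appends `E`.
      exact (((ih h1 hd h4.swap).flip h1 hd).of_refinement h3 hSV hS.swap
        fun x hx y hy hlt hxy hne => (htot x y).resolve_right
          (h5 y hy x hx hlt (E.symm' hxy) fun h => hne (E'.symm' h))).flip hE hEd
    · exact good_of_constant h

end Good

/-! ### Compactness and gluing: the partition of (i). -/

section FinitePartition

variable {M : Type w} [LinearOrder M] {F : M → M → Prop}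

/-- The set `S` carries an increasing sequence of convex definable equivalence relations for which
`f` is increasing on `S`. -/
def Simple (F : M → M → Prop) (S : Set M) : Prop :=
  ∃ Es : List (Setoid M), (∀ E ∈ Es, IsConvexEquiv E ∧ Dfn2 F E) ∧ Es.Pairwise (· ≤ ·) ∧
    ∀ x ∈ S, ∀ y ∈ S, reverseSeq (· < ·) Es x y → F x y

/-- Without a finite cover, the complements of the simple definable sets lie in an ultrafilter `V`,
but `good_of_chainBound`, applied to the total relation, puts a simple definable set in `V`. -/
theorem exists_finite_simple_cover (hW : TameSets F) (htot : ∀ x y, F x y ∨ F y x)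
    (htr : ∀ x y z, F x y → F y z → F x z) {N : ℕ}
    (hN : ∀ w x : M, ¬ Alt (col F w) Set.univ N x) :
    ∃ G : Set (Set M), G.Finite ∧ (∀ S ∈ G, Dfn1 F S ∧ Simple F S) ∧ ⋃₀ G = Set.univ := by
  by_contra! hcon
  have hne : (generate (compl '' {S | Dfn1 F S ∧ Simple F S})).NeBot := by
    rw [generate_neBot_iff]
    intro t ht htf
    have h := hcon (compl '' t) (htf.image _) (by
      rintro _ ⟨S, hS, rfl⟩
      obtain ⟨T, hT, rfl⟩ := ht hS
      rwa [compl_compl])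
    obtain ⟨x, hx⟩ := (Set.ne_univ_iff_exists_notMem _).1 h
    exact ⟨x, fun S hS => by_contra fun hxS => hx ⟨Sᶜ, ⟨S, hS, rfl⟩, hxS⟩⟩
  obtain ⟨V, hV⟩ := Ultrafilter.exists_le (generate (compl '' {S | Dfn1 F S ∧ Simple F S}))
  have hN' : ∀ w x : Star M, ¬ Alt (col (star2 F) w) Set.univ N x := fun w x h => by
    obtain ⟨i, hi⟩ := (alt_star h).exists
    exact hN _ _ hi
  obtain ⟨Es, h1, h2, S, hSV, hS, h3⟩ := good_of_chainBound (V := V) hW htot htr hN' N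
    isConvexEquiv_top ((Dfn.const True).congr fun _ => iff_of_true trivial trivial)
    fun a _ x hx => hN' a x (hx.mono (Set.subset_univ _))
  have hS' : Simple F S := ⟨Es, fun E hE => ⟨(h1 E hE).1, (h1 E hE).2.1⟩, h2,
    fun x hx y hy h => h3 x hx y hy trivial h⟩
  have hSc : Sᶜ ∈ V := hV (mem_generate_of_mem ⟨S, ⟨hS, hS'⟩, rfl⟩)
  exact Ultrafilter.compl_mem_iff_notMem.1 hSc hSV

theorem Dfn.exists_mem {ι : Type*} {P : Set ι} (hP : P.Finite) {p : ι → (ℕ → M) → Prop}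
    (h : ∀ i ∈ P, Dfn F (p i)) : Dfn F (fun v => ∃ i ∈ P, p i v) := by
  induction P, hP using Set.Finite.induction_on with
  | empty => exact (Dfn.const False).congr fun v => by simp
  | @insert i P _ _ ih =>
    exact ((h i (Or.inl rfl)).or (ih fun j hj => h j (Or.inr hj))).congr fun v => by simp

/-- The equivalence relation that agrees with `G C` on every member `C` of the partition `P`. -/
def glue {P : Set (Set M)} (hP : ConvexPartition F P) (G : Set M → Setoid M) : Setoid M where
  r x y := ∃ C ∈ P, x ∈ C ∧ y ∈ C ∧ G C x y
  iseqv :=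
    { refl := fun x => by
        obtain ⟨C, hC, hx⟩ := hP.exists_mem x
        exact ⟨C, hC, hx, hx, (G C).refl' x⟩
      symm := fun ⟨C, hC, hx, hy, h⟩ => ⟨C, hC, hy, hx, (G C).symm' h⟩
      trans := by
        rintro x y z ⟨C, hC, hx, hy, h⟩ ⟨D, hD, hy', hz, h'⟩
        obtain rfl := hP.eq hC hD hy hy'
        exact ⟨C, hC, hx, hz, (G C).trans' h h'⟩ }

theorem glue_iff {P : Set (Set M)} (hP : ConvexPartition F P) {G : Set M → Setoid M} {C : Set M}
    (hC : C ∈ P) {x y : M} (hx : x ∈ C) : glue hP G x y ↔ y ∈ C ∧ G C x y := by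
  constructor
  · rintro ⟨D, hD, hx', hy, h⟩
    obtain rfl := hP.eq hC hD hx hx'
    exact ⟨hy, h⟩
  · rintro ⟨hy, h⟩
    exact ⟨C, hC, hx, hy, h⟩

theorem isConvexEquiv_glue {P : Set (Set M)} (hP : ConvexPartition F P) {G : Set M → Setoid M}
    (hG : ∀ C ∈ P, IsConvexEquiv (G C)) : IsConvexEquiv (glue hP G) := by
  intro a
  obtain ⟨C, hC, ha⟩ := hP.exists_mem a
  have : {x | glue hP G x a} = C ∩ {x | G C x a} := by
    ext x
    refine ⟨fun h => ?_, fun h => ⟨C, hC, h.1, ha, h.2⟩⟩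
    have h' := (glue_iff hP hC ha).1 ((glue hP G).symm' h)
    exact ⟨h'.1, (G C).symm' h'.2⟩
  rw [this]
  exact (hP.convex C hC).inter (hG C hC a)

theorem dfn_glue {P : Set (Set M)} (hP : ConvexPartition F P) {G : Set M → Setoid M}
    (hG : ∀ C ∈ P, Dfn2 F (G C)) : Dfn2 F (glue hP G) :=
  Dfn.exists_mem hP.finite fun C hC =>
    ((hP.dfn C hC).sub 0).and (((hP.dfn C hC).sub 1).and (hG C hC))

theorem exists_increasing_partition (hW : TameSets F) (htot : ∀ x y, F x y ∨ F y x)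
    (htr : ∀ x y z, F x y → F y z → F x z) {N : ℕ}
    (hN : ∀ w x : M, ¬ Alt (col F w) Set.univ N x) :
    ∃ (P : Set (Set M)) (Es : List (Setoid M)), ConvexPartition F P ∧
      (∀ E ∈ Es, IsConvexEquiv E ∧ Dfn2 F E) ∧ Es.Pairwise (· ≤ ·) ∧
      ∀ C ∈ P, ∀ x ∈ C, ∀ y ∈ C, reverseSeq (· < ·) Es x y → F x y := by
  obtain ⟨G, hG, hGs, hGu⟩ := exists_finite_simple_cover hW htot htr hN
  obtain ⟨P, hP, hPG⟩ := exists_convexPartition hW hG fun S hS => (hGs S hS).1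
  have hsimple : ∀ C : Set M, ∃ Es : List (Setoid M), (∀ E ∈ Es, IsConvexEquiv E ∧ Dfn2 F E) ∧
      Es.Pairwise (· ≤ ·) ∧ (C ∈ P → ∀ x ∈ C, ∀ y ∈ C, reverseSeq (· < ·) Es x y → F x y) := by
    intro C
    by_cases hC : C ∈ P
    · obtain ⟨x, hx⟩ := Setoid.nonempty_of_mem_partition hP.isPartition hC
      obtain ⟨S, hS, hxS⟩ : x ∈ ⋃₀ G := by rw [hGu]; trivial
      have hCS := (hPG C hC S hS).resolve_right fun h => Set.disjoint_left.1 h hx hxS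
      obtain ⟨Es, h1, h2, h3⟩ := (hGs S hS).2
      exact ⟨Es, h1, h2, fun _ x hx y hy h => h3 x (hCS hx) y (hCS hy) h⟩
    · exact ⟨[], by simp, List.Pairwise.nil, fun h => absurd h hC⟩
  choose Es hEs hpair hinc using hsimple
  obtain ⟨m, hm⟩ := (hP.finite.image fun C => (Es C).length).bddAbove
  replace hm : ∀ C ∈ P, (Es C).length ≤ m := fun C hC => hm ⟨C, hC, rfl⟩
  -- Equality, placed in front, keeps the sequence increasing and reverses nothing. With equal
  -- lengths, the sequences can be glued term by term.
  let pad : Set M → List (Setoid M) := fun C => List.replicate (m - (Es C).length) ⊥ ++ Es C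
  have hlen : ∀ C ∈ P, (pad C).length = m := fun C hC => by
    have := hm C hC
    simp only [pad, List.length_append, List.length_replicate]
    omega
  have hpad : ∀ C, ∀ E ∈ pad C, IsConvexEquiv E ∧ Dfn2 F E := by
    intro C E hE
    rw [List.mem_append] at hE
    rcases hE with hE | hE
    · rw [List.eq_of_mem_replicate hE]
      exact ⟨isConvexEquiv_bot, Dfn.eq' 0 1⟩
    · exact hEs C E hE
  have hpadp : ∀ C, (pad C).Pairwise (· ≤ ·) := by
    intro C
    rw [List.pairwise_append]
    refine ⟨List.pairwise_replicate.2 (Or.inr le_rfl), hpair C, fun E hE E' _ => ?_⟩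
    rw [List.eq_of_mem_replicate hE]
    exact bot_le
  let h : ℕ → Set M → Setoid M := fun i C => (pad C).getD i ⊥
  have hget : ∀ C, ∀ i (hi : i < (pad C).length), h i C = (pad C)[i] := fun C i hi =>
    List.getD_eq_getElem _ _ hi
  have hmap : ∀ C ∈ P, (List.range m).map (fun i => h i C) = pad C := fun C hC =>
    List.ext_getElem (by simp [hlen C hC]) fun i h1 h2 => by simp [hget C i h2]
  have hh : ∀ i < m, ∀ C ∈ P, IsConvexEquiv (h i C) ∧ Dfn2 F (h i C) := fun i hi C hC => by
    rw [hget C i (by rwa [hlen C hC])]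
    exact hpad C _ (List.getElem_mem _)
  refine ⟨P, (List.range m).map fun i => glue hP (h i), hP, ?_, ?_, ?_⟩
  · intro E hE
    obtain ⟨i, hi, rfl⟩ := List.mem_map.1 hE
    rw [List.mem_range] at hi
    exact ⟨isConvexEquiv_glue hP fun C hC => (hh i hi C hC).1,
      dfn_glue hP fun C hC => (hh i hi C hC).2⟩
  · rw [List.pairwise_map]
    refine List.Pairwise.imp_of_mem (R := (· < ·)) ?_ List.pairwise_lt_range
    rintro i j hi hj hij x y ⟨C, hC, hx, hy, hxy⟩
    rw [List.mem_range] at hi hj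
    refine ⟨C, hC, hx, hy, ?_⟩
    rw [hget C i (by rwa [hlen C hC])] at hxy
    rw [hget C j (by rwa [hlen C hC])]
    exact List.pairwise_iff_getElem.1 (hpadp C) i j _ _ hij hxy
  · intro C hC x hx y hy hxy
    rw [(reverseSeq_map_congr (· < ·) (List.range m) (G' := fun i => h i C) fun i _ =>
      (glue_iff hP hC hx).trans (and_iff_right hy)).1, hmap C hC,
      reverseSeq_replicate_bot _ lt_irrefl] at hxy
    exact hinc C hC x hx y hy hxy

end FinitePartition

/-! ### Local constancy and strict monotonicity: the partition of (ii). -/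

section LocallyMonotone

variable {M : Type w} [LinearOrder M] {F : M → M → Prop}

theorem IsConvexEquiv.of_le {E : Setoid M} (hE : IsConvexEquiv E) {x y z : M} (h : E x z)
    (hxy : x ≤ y) (hyz : y ≤ z) : E x y :=
  E.symm' ((hE x).out (E.refl' x) (E.symm' h) ⟨hxy, hyz⟩)

theorem isConvexEquiv_of_le {E : Setoid M} (h : ∀ x y z, E x z → x ≤ y → y ≤ z → E x y) :
    IsConvexEquiv E := by
  intro a
  refine ⟨fun x hx z hz y hy => ?_⟩
  have hxz : E x z := E.trans' hx (E.symm' hz)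
  exact E.trans' (E.symm' (h x y z hxz hy.1 hy.2)) hx

/-- `a` and `b` are equivalent if the transitive relation `q` holds between the elements
`x < y` of the interval spanned by `a` and `b`. -/
def chainSetoid (q : M → M → Prop) (hq : ∀ x y z, q x y → q y z → q x z) : Setoid M where
  r a b := ∀ x y, x < y → (a ≤ x ∨ b ≤ x) → (y ≤ a ∨ y ≤ b) → q x y
  iseqv :=
    { refl := fun a x y hxy hx hy =>
        absurd hxy (not_lt.2 ((hy.elim id id).trans (hx.elim id id)))
      symm := fun h x y hxy hx hy => h x y hxy hx.symm hy.symm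
      trans := by
        intro a b c hab hbc x y hxy hx hy
        rcases le_or_gt y b with hyb | hyb
        · rcases hx with hx | hx
          exacts [hab x y hxy (Or.inl hx) (Or.inr hyb), hbc x y hxy (Or.inr hx) (Or.inl hyb)]
        rcases le_or_gt b x with hxb | hxb
        · rcases hy with hy | hy
          exacts [hab x y hxy (Or.inr hxb) (Or.inl hy), hbc x y hxy (Or.inl hxb) (Or.inr hy)]
        refine hq x b y ?_ ?_
        · rcases hx with hx | hx
          exacts [hab x b hxb (Or.inl hx) (Or.inr le_rfl), hbc x b hxb (Or.inr hx) (Or.inl le_rfl)]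
        · rcases hy with hy | hy
          exacts [hab b y hyb (Or.inr le_rfl) (Or.inl hy), hbc b y hyb (Or.inl le_rfl) (Or.inr hy)] }

theorem chainSetoid_iff {q : M → M → Prop} (hq : ∀ x y z, q x y → q y z → q x z) {a b : M}
    (hab : a ≤ b) : chainSetoid q hq a b ↔ ∀ x y, a ≤ x → x < y → y ≤ b → q x y := by
  constructor
  · exact fun h x y hx hxy hy => h x y hxy (Or.inl hx) (Or.inr hy)
  · exact fun h x y hxy hx hy => h x y (hx.elim id hab.trans) hxy (hy.elim (·.trans hab) id)

theorem isConvexEquiv_chainSetoid {q : M → M → Prop} (hq : ∀ x y z, q x y → q y z → q x z) :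
    IsConvexEquiv (chainSetoid q hq) := by
  refine isConvexEquiv_of_le fun x y z h hxy hyz => ?_
  rw [chainSetoid_iff hq (hxy.trans hyz)] at h
  exact (chainSetoid_iff hq hxy).2 fun u v hu huv hv => h u v hu huv (hv.trans hyz)

theorem dfn_chainSetoid {q : M → M → Prop} (hq : ∀ x y z, q x y → q y z → q x z)
    (hqd : Dfn2 F q) : Dfn2 F (chainSetoid q hq) :=
  Dfn.all (p := fun v => ∀ y, v 0 < y → (v 1 ≤ v 0 ∨ v 2 ≤ v 0) → (y ≤ v 1 ∨ y ≤ v 2) → q (v 0) y)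
    (Dfn.all (p := fun v => v 1 < v 0 → (v 2 ≤ v 1 ∨ v 3 ≤ v 1) → (v 0 ≤ v 2 ∨ v 0 ≤ v 3) →
        q (v 1) (v 0))
      ((Dfn.lt' 1 0).imp (((Dfn.le' 2 1).or (Dfn.le' 3 1)).imp
        (((Dfn.le' 0 2).or (Dfn.le' 0 3)).imp (hqd.sub 1 0)))))

theorem chainSetoid_rel {q : M → M → Prop} (hq : ∀ x y z, q x y → q y z → q x z) {x y : M}
    (h : chainSetoid q hq x y) (hxy : x < y) : q x y :=
  (chainSetoid_iff hq hxy.le).1 h x y le_rfl hxy le_rfl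

/-- The elements whose class has another element. -/
def nontrivialSet (E : Setoid M) : Set M := {a | ∃ b, a ≠ b ∧ E a b}

theorem dfn_nontrivialSet {E : Setoid M} (hE : Dfn2 F E) : Dfn1 F (nontrivialSet E) :=
  Dfn.ex (p := fun v => v 1 ≠ v 0 ∧ E (v 1) (v 0)) ((Dfn.eq' 1 0).not.and (hE.sub 1 0))

/-- The minima of such classes lie in the definable set `T` and the maxima do not. Two minima in one
convex piece of `T` would have the maximum of the lower class between them, so each piece accounts
for at most one class. -/
theorem finite_nontrivial_finite_classes (hW : TameSets F) {E : Setoid M}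
    (hE : IsConvexEquiv E) (hEd : Dfn2 F E) :
    {K ∈ E.classes | K.Finite ∧ K.Nontrivial}.Finite := by
  set T : Set M := {x | (∀ y, E x y → x ≤ y) ∧ ∃ y, E x y ∧ x < y} with hT
  have hTd : Dfn1 F T :=
    (Dfn.all (p := fun v => E (v 1) (v 0) → v 1 ≤ v 0) ((hEd.sub 1 0).imp (Dfn.le' 1 0))).and
      (Dfn.ex (p := fun v => E (v 1) (v 0) ∧ v 1 < v 0) ((hEd.sub 1 0).and (Dfn.lt' 1 0)))
  obtain ⟨G, hG, hGc, hTG⟩ := hW T hTd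
  have key : ∀ K ∈ {K ∈ E.classes | K.Finite ∧ K.Nontrivial},
      ∃ C ∈ G, ∃ m n, m < n ∧ m ∈ C ∧ K = {x | E x m} ∧ E n m ∧ n ∉ T := by
    rintro K ⟨⟨a, rfl⟩, hfin, hnt⟩
    obtain ⟨m, hm, hmin⟩ := hfin.exists_minimalFor id _ hnt.nonempty
    obtain ⟨n, hn, hmax⟩ := hfin.exists_maximalFor id _ hnt.nonempty
    replace hmin : ∀ x, E x a → m ≤ x := fun x hx =>
      (le_total m x).elim id fun h => hmin hx h
    replace hmax : ∀ x, E x a → x ≤ n := fun x hx =>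
      (le_total x n).elim id fun h => hmax hx h
    have hm' : E m a := hm
    have hn' : E n a := hn
    have hmn : m < n := by
      obtain ⟨x, hx, y, hy, hxy⟩ := hnt
      refine lt_of_le_of_ne (hmin n hn) fun h => hxy ?_
      rw [le_antisymm (h ▸ hmax x hx : x ≤ m) (hmin x hx),
        le_antisymm (h ▸ hmax y hy : y ≤ m) (hmin y hy)]
    have hmT : m ∈ T := ⟨fun y hy => hmin y (E.trans' (E.symm' hy) hm'), n,
      E.trans' hm' (E.symm' hn'), hmn⟩
    rw [hTG] at hmT
    obtain ⟨C, hC, hmC⟩ := hmT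
    refine ⟨C, hC, m, n, hmn, hmC, ?_, E.trans' hn' (E.symm' hm'), fun hnT => ?_⟩
    · ext x
      exact ⟨fun h => E.trans' h (E.symm' hm'), fun h => E.trans' h hm'⟩
    · obtain ⟨y, hy, hny⟩ := hnT.2
      exact absurd hny (not_lt.2 (hmax y (E.trans' (E.symm' hy) hn')))
  rcases isEmpty_or_nonempty M with hM | hM
  · exact Set.toFinite _
  choose! c hcG m n hmn hmc hK hnm hnT using key
  refine Set.Finite.of_injOn (f := c) (t := G) (fun K hK => hcG K hK) ?_ hG
  have aux : ∀ K ∈ {K ∈ E.classes | K.Finite ∧ K.Nontrivial},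
      ∀ K' ∈ {K ∈ E.classes | K.Finite ∧ K.Nontrivial}, c K = c K' → m K' ≤ m K := by
    intro K hK1 K' hK1' hcc
    by_contra! hlt
    have hm'T : m K' ∈ T := by rw [hTG]; exact ⟨_, hcG K' hK1', hmc K' hK1'⟩
    rcases le_or_gt (m K') (n K) with h | h
    · exact absurd (hm'T.1 _ (E.symm' (hE.of_le (E.symm' (hnm K hK1)) hlt.le h))) (not_le.2 hlt)
    · exact hnT K hK1 (by
        rw [hTG]
        exact ⟨c K', hcG K' hK1', (hGc _ (hcG K' hK1')).out (hcc ▸ hmc K hK1) (hmc K' hK1')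
          ⟨(hmn K hK1).le, h.le⟩⟩)
  intro K hK1 K' hK1' hcc
  rw [hK K hK1, hK K' hK1', le_antisymm (aux K' hK1' K hK1 hcc.symm) (aux K hK1 K' hK1' hcc)]

/-- For each successive `E`, either two points of the current interval are equivalent, and the whole
interval between them is reversed, or `E` is trivial on the interval and has no effect. -/
theorem reverseSeq_or_flip (l : List (Setoid M)) (hl : ∀ E ∈ l, IsConvexEquiv E) {a b : M}
    (hab : a < b) : ∃ a' b', a ≤ a' ∧ a' < b' ∧ b' ≤ b ∧
      ((∀ x y, a' ≤ x → x ≤ b' → a' ≤ y → y ≤ b' → (reverseSeq (· < ·) l x y ↔ x < y)) ∨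
        (∀ x y, a' ≤ x → x ≤ b' → a' ≤ y → y ≤ b' → (reverseSeq (· < ·) l x y ↔ y < x))) := by
  induction l using List.reverseRecOn with
  | nil => exact ⟨a, b, le_rfl, hab, le_rfl, Or.inl fun _ _ _ _ _ _ => Iff.rfl⟩
  | append_singleton l E ih =>
    obtain ⟨c, d, hac, hcd, hdb, h⟩ := ih fun E hE => hl E (by simp [hE])
    have hE := hl E (by simp)
    rw [reverseSeq_append]
    by_cases hex : ∃ c' d', c ≤ c' ∧ c' < d' ∧ d' ≤ d ∧ E c' d'
    · obtain ⟨c', d', hcc, hcd', hdd, hE'⟩ := hex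
      refine ⟨c', d', hac.trans hcc, hcd', hdd.trans hdb, ?_⟩
      have hrel : ∀ x y, c' ≤ x → x ≤ d' → c' ≤ y → y ≤ d' →
          (reverseOn (reverseSeq (· < ·) l) E x y ↔ reverseSeq (· < ·) l y x) := by
        intro x y h1 h2 h3 h4
        have : E x y := E.trans' (E.symm' (hE.of_le hE' h1 h2)) (hE.of_le hE' h3 h4)
        simp [reverseOn, this]
      rcases h with h | h
      · refine Or.inr fun x y h1 h2 h3 h4 => (hrel x y h1 h2 h3 h4).trans ?_
        exact h y x (hcc.trans h3) (h4.trans hdd) (hcc.trans h1) (h2.trans hdd)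
      · refine Or.inl fun x y h1 h2 h3 h4 => (hrel x y h1 h2 h3 h4).trans ?_
        exact h y x (hcc.trans h3) (h4.trans hdd) (hcc.trans h1) (h2.trans hdd)
    · refine ⟨c, d, hac, hcd, hdb, ?_⟩
      have hrel : ∀ x y, c ≤ x → x ≤ d → c ≤ y → y ≤ d → x ≠ y → ¬ E x y := by
        intro x y h1 h2 h3 h4 hne hxy
        rcases hne.lt_or_gt with hlt | hlt
        exacts [hex ⟨x, y, h1, hlt, h4, hxy⟩, hex ⟨y, x, h3, hlt, h2, E.symm' hxy⟩]
      have hrel' : ∀ x y, c ≤ x → x ≤ d → c ≤ y → y ≤ d →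
          (reverseOn (reverseSeq (· < ·) l) E x y ↔ reverseSeq (· < ·) l x y) := by
        intro x y h1 h2 h3 h4
        by_cases hxy : x = y
        · subst hxy
          simp [reverseOn]
        · simp [reverseOn, hrel x y h1 h2 h3 h4 hxy]
      exact h.imp (fun h x y h1 h2 h3 h4 => (hrel' x y h1 h2 h3 h4).trans (h x y h1 h2 h3 h4))
        fun h x y h1 h2 h3 h4 => (hrel' x y h1 h2 h3 h4).trans (h x y h1 h2 h3 h4)

/-- If `f` is increasing but not strictly, it takes equal values at two points and is constant
between them. -/
theorem constant_or_strict (htr : ∀ x y z, F x y → F y z → F x z) {a b : M} (hab : a < b)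
    (h : ∀ x y, a ≤ x → x < y → y ≤ b → F x y) :
    ∃ c d, a ≤ c ∧ c < d ∧ d ≤ b ∧ ((∀ x y, c ≤ x → x < y → y ≤ d → F x y ∧ F y x) ∨
      (∀ x y, c ≤ x → x < y → y ≤ d → ¬ F y x)) := by
  by_cases hex : ∃ c d, a ≤ c ∧ c < d ∧ d ≤ b ∧ F d c
  · obtain ⟨c, d, hac, hcd, hdb, hF⟩ := hex
    refine ⟨c, d, hac, hcd, hdb, Or.inl fun x y hx hxy hy => ⟨h x y (hac.trans hx) hxy
      (hy.trans hdb), ?_⟩⟩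
    have h1 : F y c := by
      rcases hy.eq_or_lt with rfl | hy'
      exacts [hF, htr _ _ _ (h y d (hac.trans (hx.trans hxy.le)) hy' hdb) hF]
    rcases hx.eq_or_lt with rfl | hx'
    exacts [h1, htr _ _ _ h1 (h c x hac hx' (hxy.le.trans (hy.trans hdb)))]
  · exact ⟨a, b, le_rfl, hab, le_rfl, Or.inr fun x y hx hxy hy hF => hex ⟨x, y, hx, hxy, hy, hF⟩⟩

theorem exists_locally_monotone_partition (hW : TameSets F) (htot : ∀ x y, F x y ∨ F y x)
    (htr : ∀ x y z, F x y → F y z → F x z) {P : Set (Set M)} {Es : List (Setoid M)}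
    (hP : ConvexPartition F P) (hEs : ∀ E ∈ Es, IsConvexEquiv E)
    (hinc : ∀ C ∈ P, ∀ x ∈ C, ∀ y ∈ C, reverseSeq (· < ·) Es x y → F x y) :
    ∃ (Q : Set (Set M)) (E : Setoid M), ConvexPartition F Q ∧ IsConvexEquiv E ∧ Dfn2 F E ∧
      {K ∈ E.classes | K.Finite}.Finite ∧ (∀ x y, E x y ↔ ∃ C ∈ Q, x ∈ C ∧ y ∈ C ∧ E x y) ∧
      ∀ C ∈ Q, (∀ x ∈ C, ∀ y ∈ C, E x y → x < y → F x y ∧ F y x) ∨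
        (∀ x ∈ C, ∀ y ∈ C, E x y → x < y → ¬ F y x) ∨
        (∀ x ∈ C, ∀ y ∈ C, E x y → x < y → ¬ F x y) := by
  have hswap : ∀ x y z, F y x → F z y → F z x := fun x y z h h' => htr z y x h' h
  have hq0 : ∀ x y z, (F x y ∧ F y x) → (F y z ∧ F z y) → F x z ∧ F z x := fun x y z h h' =>
    ⟨htr _ _ _ h.1 h'.1, htr _ _ _ h'.2 h.2⟩
  have hq1 : ∀ x y z, ¬ F y x → ¬ F z y → ¬ F z x := fun x y z h h' hF =>
    h' (htr _ _ _ hF ((htot x y).resolve_right h))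
  have hq2 : ∀ x y z, ¬ F x y → ¬ F y z → ¬ F x z := fun x y z h h' hF =>
    h (htr _ _ _ hF ((htot y z).resolve_left h'))
  have hd0 : Dfn2 F fun x y => F x y ∧ F y x := Dfn.rel.and (Dfn.rel' 1 0)
  have hd1 : Dfn2 F fun x y => ¬ F y x := (Dfn.rel' 1 0).not
  have hd2 : Dfn2 F fun x y => ¬ F x y := Dfn.rel.not
  set E0 := chainSetoid _ hq0
  set E1 := chainSetoid _ hq1
  set E2 := chainSetoid _ hq2
  have hE0 : Dfn2 F E0 := dfn_chainSetoid hq0 hd0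
  have hE1 : Dfn2 F E1 := dfn_chainSetoid hq1 hd1
  have hE2 : Dfn2 F E2 := dfn_chainSetoid hq2 hd2
  have hdense : ∀ C ∈ P, ∀ a ∈ C, ∀ b ∈ C, a < b → ∃ x, a ≤ x ∧ x ≤ b ∧
      (x ∈ nontrivialSet E0 ∨ x ∈ nontrivialSet E1 ∨ x ∈ nontrivialSet E2) := by
    intro C hC a ha b hb hab
    obtain ⟨c, d, hac, hcd, hdb, h⟩ := reverseSeq_or_flip Es hEs hab
    have hmem : ∀ x, c ≤ x → x ≤ d → x ∈ C := fun x h1 h2 =>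
      (hP.convex C hC).out ha hb ⟨hac.trans h1, h2.trans hdb⟩
    rcases h with h | h
    · obtain ⟨c', d', hcc, hcd', hdd, h'⟩ := constant_or_strict htr hcd fun x y hx hxy hy =>
        hinc C hC x (hmem x hx (hxy.le.trans hy)) y (hmem y (hx.trans hxy.le) hy)
          ((h x y hx (hxy.le.trans hy) (hx.trans hxy.le) hy).2 hxy)
      refine ⟨c', hac.trans hcc, hcd'.le.trans (hdd.trans hdb), ?_⟩
      rcases h' with h' | h'
      · exact Or.inl ⟨d', hcd'.ne, (chainSetoid_iff hq0 hcd'.le).2 h'⟩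
      · exact Or.inr (Or.inl ⟨d', hcd'.ne, (chainSetoid_iff hq1 hcd'.le).2 h'⟩)
    · obtain ⟨c', d', hcc, hcd', hdd, h'⟩ := constant_or_strict (F := fun x y => F y x) hswap hcd
        fun x y hx hxy hy =>
          hinc C hC y (hmem y (hx.trans hxy.le) hy) x (hmem x hx (hxy.le.trans hy))
            ((h y x (hx.trans hxy.le) hy hx (hxy.le.trans hy)).2 hxy)
      refine ⟨c', hac.trans hcc, hcd'.le.trans (hdd.trans hdb), ?_⟩
      rcases h' with h' | h'
      · exact Or.inl ⟨d', hcd'.ne, (chainSetoid_iff hq0 hcd'.le).2 fun x y h1 h2 h3 =>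
          (h' x y h1 h2 h3).symm⟩
      · exact Or.inr (Or.inr ⟨d', hcd'.ne, (chainSetoid_iff hq2 hcd'.le).2 h'⟩)
  obtain ⟨Q, hQ, hQP⟩ := exists_convexPartition hW (F := F)
    (G := P ∪ {nontrivialSet E0, nontrivialSet E1, nontrivialSet E2})
    (hP.finite.union (by simp)) (by
      rintro S (hS | rfl | rfl | rfl)
      exacts [hP.dfn S hS, dfn_nontrivialSet hE0, dfn_nontrivialSet hE1, dfn_nontrivialSet hE2])
  have hcase : ∀ C : Set M, ∃ G : Setoid M, IsConvexEquiv G ∧ Dfn2 F G ∧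
      (C ∈ Q → (C ⊆ nontrivialSet G ∨ C.Subsingleton) ∧
      ((∀ x ∈ C, ∀ y ∈ C, G x y → x < y → F x y ∧ F y x) ∨
        (∀ x ∈ C, ∀ y ∈ C, G x y → x < y → ¬ F y x) ∨
        (∀ x ∈ C, ∀ y ∈ C, G x y → x < y → ¬ F x y))) := by
    intro C
    by_cases h0 : C ⊆ nontrivialSet E0
    · exact ⟨E0, isConvexEquiv_chainSetoid hq0, hE0, fun _ =>
        ⟨Or.inl h0, Or.inl fun x _ y _ h hxy => chainSetoid_rel hq0 h hxy⟩⟩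
    by_cases h1 : C ⊆ nontrivialSet E1
    · exact ⟨E1, isConvexEquiv_chainSetoid hq1, hE1, fun _ =>
        ⟨Or.inl h1, Or.inr (Or.inl fun x _ y _ h hxy => chainSetoid_rel hq1 h hxy)⟩⟩
    by_cases h2 : C ⊆ nontrivialSet E2
    · exact ⟨E2, isConvexEquiv_chainSetoid hq2, hE2, fun _ =>
        ⟨Or.inl h2, Or.inr (Or.inr fun x _ y _ h hxy => chainSetoid_rel hq2 h hxy)⟩⟩
    -- The cell misses all three sets of nontrivial points, so by `hdense` it has at most one point
    -- and any choice of relation will do.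
    refine ⟨E0, isConvexEquiv_chainSetoid hq0, hE0, fun hC => ⟨Or.inr ?_,
      Or.inl fun x _ y _ h hxy => chainSetoid_rel hq0 h hxy⟩⟩
    have hd : ∀ x ∈ C, ¬ (x ∈ nontrivialSet E0 ∨ x ∈ nontrivialSet E1 ∨ x ∈ nontrivialSet E2) := by
      rintro x hx (h | h | h)
      · exact Set.disjoint_left.1 ((hQP C hC _ (by simp)).resolve_left h0) hx h
      · exact Set.disjoint_left.1 ((hQP C hC _ (by simp)).resolve_left h1) hx h
      · exact Set.disjoint_left.1 ((hQP C hC _ (by simp)).resolve_left h2) hx h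
    have hlt : ∀ a ∈ C, ∀ b ∈ C, ¬ a < b := by
      intro a ha b hb hab
      obtain ⟨D, hD, haD⟩ := hP.exists_mem a
      have hCD := (hQP C hC D (Or.inl hD)).resolve_right fun h => Set.disjoint_left.1 h ha haD
      obtain ⟨x, hax, hxb, hx⟩ := hdense D hD a haD b (hCD hb) hab
      exact hd x ((hQ.convex C hC).out ha hb ⟨hax, hxb⟩) hx
    exact fun a ha b hb => le_antisymm (not_lt.1 (hlt b hb a ha)) (not_lt.1 (hlt a ha b hb))
  choose G hGc hGd hG using hcase
  have hglue := isConvexEquiv_glue hQ fun C _ => hGc C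
  have hglued := dfn_glue hQ fun C _ => hGd C
  -- A class made trivial by cutting at the cell `C` sits at an end of `C`, which leaves finitely
  -- many new singleton classes.
  have hext : ∀ C ∈ Q, ∀ {x}, x ∈ C → ∀ {z}, G C x z → (∀ y, glue hQ G x y → y = x) → z ≠ x →
      IsLeast C x ∨ IsGreatest C x := by
    intro C hC x hx z hz htriv hne
    have htriv' : ∀ y ∈ C, G C x y → y = x := fun y hy h =>
      htriv y ((glue_iff hQ hC hx).2 ⟨hy, h⟩)
    have hzC : z ∉ C := fun h => hne (htriv' z h hz)
    rcases hne.lt_or_gt with hlt | hlt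
    · refine Or.inl ⟨hx, fun y hy => not_lt.1 fun hyx => ?_⟩
      rcases le_or_gt y z with h | h
      · exact hzC ((hQ.convex C hC).out hy hx ⟨h, hlt.le⟩)
      · exact hyx.ne (htriv' y hy ((G C).trans' hz
          ((hGc C).of_le ((G C).symm' hz) h.le hyx.le)))
    · refine Or.inr ⟨hx, fun y hy => not_lt.1 fun hyx => ?_⟩
      rcases le_or_gt z y with h | h
      · exact hzC ((hQ.convex C hC).out hx hy ⟨hlt.le, h⟩)
      · exact hyx.ne' (htriv' y hy ((hGc C).of_le hz hyx.le h.le))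
  refine ⟨Q, glue hQ G, hQ, hglue, hglued, ?_, ?_, fun C hC => ?_⟩
  · have hends : (⋃ C ∈ Q, {x | IsLeast C x} ∪ {x | IsGreatest C x}).Finite :=
      hQ.finite.biUnion fun C _ => Set.Finite.union
        (Set.Subsingleton.finite fun _ h _ h' => h.unique h')
        (Set.Subsingleton.finite fun _ h _ h' => h.unique h')
    refine ((finite_nontrivial_finite_classes hW hglue hglued).union
      (hends.image fun x => ({x} : Set M))).subset ?_
    rintro K ⟨hK, hfin⟩
    by_cases hnt : K.Nontrivial
    · exact Or.inl ⟨hK, hfin, hnt⟩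
    rw [Set.not_nontrivial_iff] at hnt
    obtain ⟨x, rfl⟩ := hK
    have hxx : glue hQ G x x := (glue hQ G).refl' x
    refine Or.inr ⟨x, ?_, (hnt.eq_singleton_of_mem hxx).symm⟩
    have htriv : ∀ y, glue hQ G x y → y = x := fun y hy => hnt ((glue hQ G).symm' hy) hxx
    obtain ⟨C, hC, hx⟩ := hQ.exists_mem x
    refine Set.mem_biUnion hC ?_
    rcases (hG C hC).1 with h | h
    · obtain ⟨z, hne, hz⟩ := h hx
      exact hext C hC hx hz htriv hne.symm
    · exact Or.inl ⟨hx, fun y hy => (h hx hy).le⟩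
  · intro x y
    refine ⟨fun h => ?_, fun ⟨_, _, _, _, h⟩ => h⟩
    obtain ⟨C, hC, hx, hy, h'⟩ := h
    exact ⟨C, hC, hx, hy, C, hC, hx, hy, h'⟩
  · have hr : ∀ x ∈ C, ∀ y, glue hQ G x y → G C x y := fun x hx y h =>
      ((glue_iff hQ hC hx).1 h).2
    exact (hG C hC).2.imp (fun h x hx y hy hxy => h x hx y hy (hr x hx y hxy))
      (Or.imp (fun h x hx y hy hxy => h x hx y hy (hr x hx y hxy))
        fun h x hx y hy hxy => h x hx y hy (hr x hx y hxy))

end LocallyMonotone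

/-! ### Bounds on position changes, and their transfer to an ultraproduct. -/

section UniformBound

variable {M : Type w} [LinearOrder M] {F : M → M → Prop}

theorem alt_of_eventually_alt [Nonempty M] {N : Type*} [LinearOrder N] {c : (ℕ → M) → N}
    (hlt : ∀ x y, (∀ᶠ i in hyperfilter ℕ, x i < y i) → c x < c y) {R : N → N → Prop}
    (hR : ∀ x y, R (c x) (c y) ↔ ∀ᶠ i in hyperfilter ℕ, F (x i) (y i)) {n : ℕ} {w x : ℕ → M}
    (h : ∀ᶠ i in hyperfilter ℕ, Alt (col F (w i)) Set.univ n (x i)) :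
    Alt (col R (c w)) Set.univ n (c x) := by
  induction n generalizing x with
  | zero => trivial
  | succ n ih =>
    obtain ⟨y, hy⟩ := (h.mono fun i hi => hi.2).choice
    refine ⟨trivial, c y, hlt _ _ (hy.mono fun i hi => hi.1), ih (hy.mono fun i hi => hi.2.1),
      fun heq => ?_⟩
    have h1 := iff_of_eq (congrArg Prod.fst heq)
    have h2 := iff_of_eq (congrArg Prod.snd heq)
    simp only [col, hR] at h1 h2
    have hfst : ∀ᶠ i in hyperfilter ℕ, (F (y i) (w i) ↔ F (x i) (w i)) := by
      by_cases h : ∀ᶠ i in hyperfilter ℕ, F (y i) (w i)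
      · filter_upwards [h, h1.1 h] with i hi hi' using iff_of_true hi hi'
      · filter_upwards [Ultrafilter.eventually_not.2 h, Ultrafilter.eventually_not.2
          (mt h1.2 h)] with i hi hi' using iff_of_false hi hi'
    have hsnd : ∀ᶠ i in hyperfilter ℕ, (F (w i) (y i) ↔ F (w i) (x i)) := by
      by_cases h : ∀ᶠ i in hyperfilter ℕ, F (w i) (y i)
      · filter_upwards [h, h2.1 h] with i hi hi' using iff_of_true hi hi'
      · filter_upwards [Ultrafilter.eventually_not.2 h, Ultrafilter.eventually_not.2
          (mt h2.2 h)] with i hi hi' using iff_of_false hi hi'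
    obtain ⟨i, hi, hi1, hi2⟩ := (hy.and (hfst.and hsnd)).exists
    exact hi.2.2 (Prod.ext (propext hi1) (propext hi2))

/-- The four sets of points with prescribed position split into finitely many convex pieces of
constant color. -/
theorem exists_alt_bound {N : Type*} [LinearOrder N] {R : N → N → Prop} {w : N}
    (h : ∀ p q : Prop, ∃ G : Set (Set N), G.Finite ∧ (∀ C ∈ G, C.OrdConnected) ∧
      {x | (R x w ↔ p) ∧ (R w x ↔ q)} = ⋃₀ G) :
    ∃ n, ∀ x, ¬ Alt (col R w) Set.univ n x := by
  choose G hG hGc hGe using h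
  have hfin : (⋃ i : Prop × Prop, G i.1 i.2).Finite := Set.finite_iUnion fun i => hG i.1 i.2
  refine ⟨_, fun x hx => (Alt.lt_ncard hfin ?_ ?_ ?_ hx).false⟩
  · intro C hC
    obtain ⟨i, hi⟩ := Set.mem_iUnion.1 hC
    exact hGc _ _ C hi
  · intro x _
    have : x ∈ ⋃₀ G (R x w) (R w x) := by
      rw [← hGe]
      exact ⟨Iff.rfl, Iff.rfl⟩
    obtain ⟨C, hC, hx⟩ := this
    exact ⟨C, Set.mem_iUnion.2 ⟨(R x w, R w x), hC⟩, hx⟩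
  · intro C hC x hx y hy
    obtain ⟨i, hi⟩ := Set.mem_iUnion.1 hC
    have hmem : ∀ z ∈ C, z ∈ {x | (R x w ↔ i.1) ∧ (R w x ↔ i.2)} := fun z hz => by
      rw [hGe]
      exact ⟨C, hi, hz⟩
    exact Prod.ext (propext ((hmem x hx).1.trans (hmem y hy).1.symm))
      (propext ((hmem x hx).2.trans (hmem y hy).2.symm))

end UniformBound

/-! ### From the reduct to first-order definability in `L`. -/

section FirstOrder

open FirstOrder.Language

variable {L : FirstOrder.Language.{u, v}} {M : Type w} [L.Structure M] {A : Set M}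

theorem definable₂_iff {e : M → M → Prop} :
    A.Definable₂ L {q | e q.1 q.2} ↔ A.Definable L {v : Fin 2 → M | e (v 0) (v 1)} := Iff.rfl

theorem definable_comp₂ {e : M → M → Prop} (h : A.Definable₂ L {q | e q.1 q.2}) {α : Type*}
    (i j : α) : A.Definable L {v : α → M | e (v i) (v j)} :=
  Set.Definable.preimage_comp ![i, j] h

/-- The relation is the complement of a projection that quantifies over the coordinates of both
values of `f`. -/
theorem definable_not_tri {n : ℕ} {D : Set (Fin n → M)} {tri : D → D → Prop}
    (hD : IsDefinableLinearOrder L A D tri) {f : M → D} (hf : IsDefinableFun L A f) :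
    A.Definable₂ L {q : M × M | ¬ tri (f q.2) (f q.1)} := by
  have h1 := hD.2.1.preimage_comp (Sum.inr : _ → Fin 2 ⊕ (Fin n ⊕ Fin n))
  have h2 := hf.preimage_comp (Sum.elim (fun _ => Sum.inl 1) fun j => Sum.inr (Sum.inl j) :
    Unit ⊕ Fin n → Fin 2 ⊕ (Fin n ⊕ Fin n))
  have h3 := hf.preimage_comp (Sum.elim (fun _ => Sum.inl 0) fun j => Sum.inr (Sum.inr j) :
    Unit ⊕ Fin n → Fin 2 ⊕ (Fin n ⊕ Fin n))
  refine (congrArg (A.Definable L) (Set.ext fun v => ?_)).mpr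
    (h1.inter (h2.inter h3)).exists_of_finite.compl
  refine not_congr ⟨fun h => ?_, ?_⟩
  · refine ⟨Sum.elim (f (v 1) : Fin n → M) (f (v 0) : Fin n → M),
      ⟨(f (v 1)).2, (f (v 0)).2, h⟩, rfl, rfl⟩
  · rintro ⟨u, ⟨hx, hy, h⟩, h1, h2⟩
    have e1 : f (v 1) = ⟨_, hx⟩ := Subtype.ext h1
    have e2 : f (v 0) = ⟨_, hy⟩ := Subtype.ext h2
    change tri (f (v 1)) (f (v 0))
    rwa [e1, e2]

variable [L.IsOrdered] [LinearOrder M] [L.OrderedStructure M]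

theorem definable_le {α : Type*} (i j : α) : A.Definable L {v : α → M | v i ≤ v j} := by
  refine Set.Definable.mono (A := ∅) (Set.empty_definable_iff.2
    ⟨(leSymb : L.Relations 2).formula₂ (Term.var i) (Term.var j), ?_⟩) (Set.empty_subset A)
  ext v
  simp [Formula.realize_rel₂]

theorem definable_of_dfn {F : M → M → Prop} (hF : A.Definable₂ L {q | F q.1 q.2})
    {p : (ℕ → M) → Prop} (hp : Dfn F p) {α : Type} [Finite α] (g : ℕ → α) :
    A.Definable L {v : α → M | p (v ∘ g)} := by
  induction hp generalizing α with
  | lt =>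
    convert (definable_le (L := L) (A := A) (g 1) (g 0)).compl using 1
    ext v
    simp
  | rel => exact definable_comp₂ hF (g 0) (g 1)
  | not _ ih => exact (ih g).compl
  | and _ _ ih ih' => exact (ih g).inter (ih' g)
  | @ex p _ ih =>
    -- The extra point `none` carries the quantified variable; restriction along `some` projects it
    -- away.
    have h := (ih (cons none (some ∘ g) : ℕ → Option α)).image_comp (some : α → Option α)
    convert h using 1
    ext v
    constructor
    · rintro ⟨x, hx⟩
      refine ⟨fun o => o.elim x v, ?_, rfl⟩
      have : (fun o => Option.elim o x v) ∘ cons none (some ∘ g) = cons x (v ∘ g) := by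
        funext n
        cases n <;> rfl
      change p _
      rwa [this]
    · rintro ⟨u, hu, rfl⟩
      refine ⟨u none, ?_⟩
      have : cons (u none) ((u ∘ some) ∘ g) = u ∘ cons none (some ∘ g) := by
        funext n
        cases n <;> rfl
      change p _
      rwa [this]
  | ren l _ ih => exact ih fun k => g (l.getD k 0)

theorem definable₁_of_dfn1 {F : M → M → Prop} (hF : A.Definable₂ L {q | F q.1 q.2}) {S : Set M}
    (hS : Dfn1 F S) : A.Definable₁ L S :=
  definable_of_dfn hF hS fun _ => (0 : Fin 1)

theorem definableEquiv_of_dfn2 {F : M → M → Prop} (hF : A.Definable₂ L {q | F q.1 q.2})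
    {E : Setoid M} (hE : Dfn2 F E) : DefinableEquiv L A E :=
  definable_of_dfn hF hE fun n => if n = 0 then (0 : Fin 2) else 1

theorem tameSets_of_weaklyOMinimal (hM : WeaklyOMinimalStructure L M) {F : M → M → Prop}
    (hF : A.Definable₂ L {q | F q.1 q.2}) : TameSets F := fun S hS =>
  hM S ((definable₁_of_dfn1 hF hS).mono (Set.subset_univ A))

/-- If chains of every length `n` exist, relative to points `b n`, then in the ultraproduct the
single point represented by `b` has chains of every length. The ultraproduct is a model of the
theory, so weak o-minimality there bounds these chains. -/
theorem exists_uniform_alt_bound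
    (hwom : WeaklyOMinimalTheory.{u, v, w} (L.completeTheory M)) {F : M → M → Prop}
    (hF : A.Definable₂ L {q | F q.1 q.2}) :
    ∃ n, ∀ w x : M, ¬ Alt (col F w) Set.univ n x := by
  classical
  rcases isEmpty_or_nonempty M with hM | hM
  · exact ⟨0, fun w => isEmptyElim w⟩
  by_contra! hcon
  choose b x hx using hcon
  let N := ((hyperfilter ℕ : Ultrafilter ℕ) : Filter ℕ).Product fun _ : ℕ => M
  let c : (ℕ → M) → N := fun y => (y : ((hyperfilter ℕ : Ultrafilter ℕ) : Filter ℕ).Product _)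
  have hreal : ∀ {β : Type w} (φ : L.Formula β) (y : β → ℕ → M),
      φ.Realize (fun i => c (y i)) ↔ ∀ᶠ i in hyperfilter ℕ, φ.Realize fun j => y j i :=
    fun φ y => Ultraproduct.realize_formula_cast φ y
  have hcomplete : N ⊨ L.completeTheory M := by
    rw [Theory.model_iff]
    intro φ hφ
    exact (Ultraproduct.sentence_realize φ).2 (Eventually.of_forall fun _ => hφ)
  have hlin : N ⊨ L.linearOrderTheory := by
    rw [Theory.model_iff]
    intro φ hφ
    exact (Ultraproduct.sentence_realize φ).2
      (Eventually.of_forall fun _ => Theory.realize_sentence_of_mem L.linearOrderTheory hφ)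
  let : LinearOrder N := L.linearOrderOfModels N
  have : L.OrderedStructure N := inferInstanceAs (@OrderedStructure L N _ (L.leOfStructure N) _)
  have hle : ∀ y z : ℕ → M, c y ≤ c z ↔ ∀ᶠ i in hyperfilter ℕ, y i ≤ z i := by
    intro y z
    have h := hreal ((leSymb : L.Relations 2).formula₂ (Term.var (ULift.up 0 : ULift (Fin 2)))
      (Term.var (ULift.up 1))) (fun j => ![y, z] j.down)
    simpa [Formula.realize_rel₂] using h
  have hlt : ∀ y z : ℕ → M, (∀ᶠ i in hyperfilter ℕ, y i < z i) → c y < c z := by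
    intro y z h
    rw [← not_le, hle, ← Ultrafilter.eventually_not]
    exact h.mono fun i hi => not_le.2 hi
  obtain ⟨φ, hφ⟩ := Set.definable_iff_exists_formula_sum.1 (definable₂_iff.1 hF)
  have hφ' : ∀ y z : M, F y z ↔ φ.Realize (Sum.elim (fun a : A => (a : M)) ![y, z]) := fun y z => by
    have := Set.ext_iff.1 hφ ![y, z]
    simpa using this
  let const : A → N := fun a => c fun _ => (a : M)
  let R : N → N → Prop := fun y z => φ.Realize (Sum.elim const ![y, z])
  have hR : ∀ y z, R (c y) (c z) ↔ ∀ᶠ i in hyperfilter ℕ, F (y i) (z i) := by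
    intro y z
    have h := hreal φ (Sum.elim (fun (a : A) _ => (a : M)) ![y, z])
    have h1 : (fun j => c (Sum.elim (fun (a : A) _ => (a : M)) ![y, z] j)) =
        Sum.elim const ![c y, c z] := by
      funext j
      rcases j with a | j
      · rfl
      · fin_cases j <;> rfl
    have h2 : ∀ i, (fun j =>
        (Sum.elim (fun (a : A) _ => (a : M)) ![y, z] : A ⊕ Fin 2 → ℕ → M) j i) =
        Sum.elim (fun a : A => (a : M)) ![y i, z i] := by
      intro i
      funext j
      rcases j with a | j
      · rfl
      · fin_cases j <;> rfl
    simp only [h1, h2, ← hφ'] at h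
    exact h
  have hdef : ∀ g : A ⊕ Fin 2 → (Set.univ : Set N) ⊕ Fin 1,
      (Set.univ : Set N).Definable L {v : Fin 1 → N | φ.Realize (Sum.elim (↑) v ∘ g)} := fun g =>
    Set.definable_iff_exists_formula_sum.2 ⟨φ.relabel g, by
      ext v
      simp [Formula.realize_relabel]⟩
  have hd1 : ∀ a : N, (Set.univ : Set N).Definable L {v : Fin 1 → N | R (v 0) a} := fun a => by
    convert hdef (Sum.elim (fun d => Sum.inl ⟨const d, trivial⟩) ![Sum.inr 0, Sum.inl ⟨a, trivial⟩])
      using 3 with v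
    refine iff_of_eq (congrArg φ.Realize ?_)
    funext j
    rcases j with d | j
    · rfl
    · fin_cases j <;> rfl
  have hd2 : ∀ a : N, (Set.univ : Set N).Definable L {v : Fin 1 → N | R a (v 0)} := fun a => by
    convert hdef (Sum.elim (fun d => Sum.inl ⟨const d, trivial⟩) ![Sum.inl ⟨a, trivial⟩, Sum.inr 0])
      using 3 with v
    refine iff_of_eq (congrArg φ.Realize ?_)
    funext j
    rcases j with d | j
    · rfl
    · fin_cases j <;> rfl
  have hiff : ∀ (S : Set (Fin 1 → N)) (p : Prop), (Set.univ : Set N).Definable L S →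
      (Set.univ : Set N).Definable L {v | v ∈ S ↔ p} := fun S p hS => by
    by_cases hp : p
    · convert hS using 1
      ext v
      simp [hp]
    · convert hS.compl using 1
      ext v
      simp [hp]
  obtain ⟨n, hn⟩ := exists_alt_bound (R := R) (w := c b) fun p q =>
    hwom N hcomplete _ ((hiff _ p (hd1 (c b))).inter (hiff _ q (hd2 (c b))))
  have hev : ∀ᶠ i in hyperfilter ℕ, ∃ y, Alt (col F (b i)) Set.univ n y := by
    have hge : ∀ᶠ i in hyperfilter ℕ, n ≤ i := Nat.hyperfilter_le_atTop (eventually_ge_atTop n)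
    exact hge.mono fun i hi => (hx i).exists_of_le hi
  obtain ⟨y, hy⟩ := hev.choice
  exact hn _ (alt_of_eventually_alt hlt hR hy)

end FirstOrder

end WeakMono

/-! ### Assembly, with `F` read off from `f`. -/

open FirstOrder in
theorem theorem3 {L : FirstOrder.Language.{u, v}} [L.IsOrdered] {M : Type w} [L.Structure M]
    [LinearOrder M] [L.OrderedStructure M]
    (hwom : WeakMono.WeaklyOMinimalTheory.{u, v, w} (L.completeTheory M))
    (A : Set M) {n : ℕ} (D : Set (Fin n → M)) (tri : D → D → Prop)
    (hD : WeakMono.IsDefinableLinearOrder L A D tri)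
    (f : M → D) (hf : WeakMono.IsDefinableFun L A f) :
    (∃ (P : Set (Set M)) (Es : List (Setoid M)),
      WeakMono.IsFiniteConvexDefinablePartition L A P ∧
      (∀ E ∈ Es, WeakMono.IsConvexEquiv E ∧ WeakMono.DefinableEquiv L A E) ∧
      Es.Pairwise (· ≤ ·) ∧
      ∀ C ∈ P, WeakMono.IncreasingOnRel (WeakMono.reverseSeq (· < ·) Es) tri f C) ∧
    (∃ (P : Set (Set M)) (E : Setoid M),
      WeakMono.IsFiniteConvexDefinablePartition L A P ∧
      WeakMono.IsConvexEquiv E ∧ WeakMono.DefinableEquiv L A E ∧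
      {K ∈ E.classes | K.Finite}.Finite ∧
      (∀ x y, E x y ↔ ∃ C ∈ P, x ∈ C ∧ y ∈ C ∧ E x y) ∧
      ∀ C ∈ P,
        (∀ a ∈ C, WeakMono.ConstantOn f {x | E x a}) ∨
        (∀ a ∈ C, WeakMono.StrictIncreasingOnRel (· < ·) tri f {x | E x a}) ∨
        (∀ a ∈ C, WeakMono.StrictDecreasingOnRel (· < ·) tri f {x | E x a})) := by
  have hord := hD.2.2
  have htri : ∀ a b : D, tri a b ∨ a = b ∨ tri b a := fun a b => trichotomous_of tri a b
  -- As `tri` is a strict total order, this says `f x ≤ f y`.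
  let F : M → M → Prop := fun x y => ¬ tri (f y) (f x)
  have hF : A.Definable₂ L {q : M × M | F q.1 q.2} := WeakMono.definable_not_tri hD hf
  have htot : ∀ x y, F x y ∨ F y x := fun x y => by
    by_contra! h
    simp only [F, not_not] at h
    exact asymm_of tri h.1 h.2
  have hFiff : ∀ x y, F x y ↔ tri (f x) (f y) ∨ f x = f y := fun x y => by
    constructor
    · intro h
      rcases htri (f x) (f y) with h' | h' | h'
      exacts [Or.inl h', Or.inr h', absurd h' h]
    · rintro (h | h) h'
      · exact asymm_of tri h h'
      · rw [h] at h'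
        exact irrefl_of tri _ h'
  have htr : ∀ x y z, F x y → F y z → F x z := fun x y z h h' => by
    rw [hFiff] at h h' ⊢
    rcases h with h | h
    · rcases h' with h' | h'
      exacts [Or.inl (trans_of tri h h'), Or.inl (h' ▸ h)]
    · rwa [h]
  have hM : WeakMono.WeaklyOMinimalStructure L M := hwom M inferInstance
  have hW := WeakMono.tameSets_of_weaklyOMinimal hM hF
  obtain ⟨N, hN⟩ := WeakMono.exists_uniform_alt_bound hwom hF
  have hpart : ∀ P, WeakMono.ConvexPartition F P →
      WeakMono.IsFiniteConvexDefinablePartition L A P := fun P hP =>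
    ⟨hP.finite, hP.isPartition, fun C hC =>
      ⟨hP.convex C hC, WeakMono.definable₁_of_dfn1 hF (hP.dfn C hC)⟩⟩
  obtain ⟨P, Es, hP, hEs, hpair, hinc⟩ := WeakMono.exists_increasing_partition hW htot htr hN
  obtain ⟨Q, E, hQ, hE, hEd, hfin, hsub, hmono⟩ :=
    WeakMono.exists_locally_monotone_partition hW htot htr hP (fun E h => (hEs E h).1) hinc
  refine ⟨⟨P, Es, hpart P hP, fun E h => ⟨(hEs E h).1,
      WeakMono.definableEquiv_of_dfn2 hF (hEs E h).2⟩, hpair, fun C hC x hx y hy h =>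
      (hFiff x y).1 (hinc C hC x hx y hy h)⟩,
    ⟨Q, E, hpart Q hQ, hE, WeakMono.definableEquiv_of_dfn2 hF hEd, hfin, hsub, fun C hC => ?_⟩⟩
  have hmem : ∀ a ∈ C, ∀ x, E x a → x ∈ C := fun a ha x hx => by
    obtain ⟨C', hC', hxC', haC', _⟩ := (hsub x a).1 hx
    rwa [hQ.eq hC hC' ha haC']
  have hrel : ∀ a ∈ C, ∀ x ∈ {x | E x a}, ∀ y ∈ {x | E x a}, x ∈ C ∧ y ∈ C ∧ E x y :=
    fun a ha x hx y hy => ⟨hmem a ha x hx, hmem a ha y hy, E.trans' hx (E.symm' hy)⟩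
  refine (hmono C hC).imp (fun h a ha x hx y hy => ?_)
    (Or.imp (fun h a ha x hx y hy hxy => ?_) fun h a ha x hx y hy hxy => ?_)
  · obtain ⟨h1, h2, h3⟩ := hrel a ha x hx y hy
    have heq : F x y ∧ F y x → f x = f y := fun h => by
      rcases (hFiff x y).1 h.1 with h' | h'
      exacts [absurd h' h.2, h']
    rcases lt_trichotomy x y with hxy | rfl | hxy
    · exact heq (h x h1 y h2 h3 hxy)
    · rfl
    · exact heq (h y h2 x h1 (E.symm' h3) hxy).symm
  · obtain ⟨h1, h2, h3⟩ := hrel a ha x hx y hy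
    exact not_not.1 (h x h1 y h2 h3 hxy)
  · obtain ⟨h1, h2, h3⟩ := hrel a ha x hx y hy
    exact not_not.1 (h x h1 y h2 h3 hxy)
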